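/- Let $\mathfrak g$ be a finite-dimensional complex simple Lie algebra with Cartan subalgebra $\mathfrak h$, root system $R$, a fixed set of simple roots $\{\alpha_i\}_{i\in I}$ with corresponding simple coroots $h_i\in\mathfrak h$, positive roots $R^+$ and dominant integral weights $P^+$; let $(\cdot,\cdot)$ be the form on $\mathfrak h^*$ induced by the Killing form. For $\mu\in P^+$ let $V(\mu)$ be the simple $\mathfrak g$-module of highest weight $\mu$, that is, the $\mathfrak g$-module generated by $v_\mu$ with defining relations $hv_\mu=\mu(h)v_\mu$ for $h\in\mathfrak h$, $\mathfrak g_{\alpha_i}v_\mu=0$ and $y^{\mu(h_i)+1}v_\mu=0$ for $y\in\mathfrak g_{-\alpha_i}$, $i\in I$. Let $\mathfrak g\ltimes\mathfrak g_{\rm ad}$ be the Lie algebra $\mathfrak g\oplus\mathfrak g$ with bracket $[(x,y),(x',y')]=([x,x'],[x,y']+[y,x'])$, graded by giving $\mathfrak g=\{(x,0)\}$ degree $0$ and $\mathfrak g_{\rm ad}=\{(0,y)\}$ degree $1$. Let $\mathcal G_2$ be the category of graded modules $V=\bigoplus_{k\ge 0}V[k]$ over $\mathfrak g\ltimes\mathfrak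 g_{\rm ad}$ (that is, $\mathfrak g V[k]\subset V[k]$ and $\mathfrak g_{\rm ad}V[k]\subset V[k+1]$) with all $V[k]$ finite-dimensional, with grading-preserving module homomorphisms as morphisms. Let $\tau_r$ be the grading shift by $r\ge 0$: $(\tau_rV)[k]=V[k-r]$ for $k\ge r$ and $(\tau_rV)[k]=0$ for $k<r$. For a subset $\Gamma\subset P^+\times\mathbb Z_{\ge0}$, let $\mathcal G_2[\Gamma]$ be the full subcategory of those $V$ in $\mathcal G_2$ such that $\operatorname{Hom}_{\mathfrak g}(V(\nu),V[s])\ne0$ implies $(\nu,s)\in\Gamma$, and for $V$ in $\mathcal G_2$ let $V^\Gamma$ be the maximal quotient of $V$ (by a graded submodule) that lies in $\mathcal G_2[\Gamma]$. Let $P(\mu,r)=U(\mathfrak g\ltimes\mathfrak g_{\rm ad})\otimes_{U(\mathfrak g)}V(\mu)$ with $V(\mu)$ placed in degree $r$. For $\lambda\in P^+$ and $S\subset R$ put $$\Gamma(\lambda,S)=\Big\{(\mu,r)\in P^+\times\mathbb Z_{\ge0}\ :\ \mu=\lambda-\sum_{\beta\in S}n_\beta\beta,\ \ \sum_{\beta\in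 S}n_\beta=r\ \text{ for some } n_\beta\in\mathbb Z_{\ge0}\Big\}.$$ Let $\Psi\subset R^+$ be such that $\Psi=\{\alpha\in R:(\alpha,\xi)=\max_{\beta\in R}(\beta,\xi)\}$ for some $\xi\in P^+$, let $\lambda\in P^+$, put $\Gamma=\Gamma(\lambda,\Psi)$, and let $(\mu,r)\in\Gamma$. Then the maximal quotients $P(\mu,r)^\Gamma$ and $P(\mu,0)^{\Gamma(\mu,\Psi)}$ are well defined, that is, the quotient of $P(\mu,r)$ (respectively $P(\mu,0)$) by the intersection of all graded submodules with quotient in $\mathcal G_2[\Gamma]$ (respectively $\mathcal G_2[\Gamma(\mu,\Psi)]$) lies again in that subcategory, and there is an isomorphism in $\mathcal G_2$ $$\tau_r\,P(\mu,0)^{\Gamma(\mu,\Psi)}\;\cong\;P(\mu,r)^{\Gamma}.$$ -/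

import Mathlib

open CategoryTheory TensorProduct

universe u

noncomputable section

/-! ### The Lie algebra `𝔤 ⋉ 𝔤_ad` -/

/-- The Lie algebra `𝔤 ⋉ 𝔤_ad`: the vector space `𝔤 ⊕ 𝔤` with the bracket
`[(x, y), (x', y')] = ([x, x'], [x, y'] + [y, x'])`. -/
@[ext] structure AdExt (𝔤 : Type u) : Type u where
  fst : 𝔤
  snd : 𝔤

namespace AdExt

/-- As a set, `𝔤 ⋉ 𝔤_ad` is `𝔤 × 𝔤`. -/
def toProd {𝔤 : Type u} : AdExt 𝔤 ≃ 𝔤 × 𝔤 where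
  toFun p := (p.fst, p.snd)
  invFun p := ⟨p.1, p.2⟩

variable {𝔤 : Type u} [LieRing 𝔤]

instance : AddCommGroup (AdExt 𝔤) := toProd.addCommGroup

instance : Bracket (AdExt 𝔤) (AdExt 𝔤) where
  bracket p q := ⟨⁅p.fst, q.fst⁆, ⁅p.fst, q.snd⁆ + ⁅p.snd, q.fst⁆⟩

@[simp] theorem add_fst (p q : AdExt 𝔤) : (p + q).fst = p.fst + q.fst := rfl
@[simp] theorem add_snd (p q : AdExt 𝔤) : (p + q).snd = p.snd + q.snd := rfl
@[simp] theorem zero_fst : (0 : AdExt 𝔤).fst = 0 := rfl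
@[simp] theorem zero_snd : (0 : AdExt 𝔤).snd = 0 := rfl
@[simp] theorem lie_fst (p q : AdExt 𝔤) : ⁅p, q⁆.fst = ⁅p.fst, q.fst⁆ := rfl
@[simp] theorem lie_snd (p q : AdExt 𝔤) :
    ⁅p, q⁆.snd = ⁅p.fst, q.snd⁆ + ⁅p.snd, q.fst⁆ := rfl

instance : LieRing (AdExt 𝔤) where
  add_lie p q s := by ext <;> simp; abel
  lie_add p q s := by ext <;> simp; abel
  lie_self p := by
    ext
    · simp
    · rw [lie_snd, ← lie_skew p.fst p.snd, neg_add_cancel, zero_snd]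
  leibniz_lie p q s := by
    ext
    · simp
    · simp only [lie_snd, lie_fst, add_snd, lie_add, add_lie]
      rw [leibniz_lie p.fst q.fst s.snd, leibniz_lie p.fst q.snd s.fst,
        leibniz_lie p.snd q.fst s.fst]
      abel

variable [LieAlgebra ℂ 𝔤]

instance : Module ℂ (AdExt 𝔤) := toProd.module ℂ

@[simp] theorem smul_fst (c : ℂ) (p : AdExt 𝔤) : (c • p).fst = c • p.fst := rfl
@[simp] theorem smul_snd (c : ℂ) (p : AdExt 𝔤) : (c • p).snd = c • p.snd := rfl

instance : LieAlgebra ℂ (AdExt 𝔤) where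
  lie_smul c p q := by ext <;> simp

/-- The inclusion `x ↦ (x, 0)` of `𝔤` into `𝔤 ⋉ 𝔤_ad`. -/
def inl : 𝔤 →ₗ⁅ℂ⁆ AdExt 𝔤 where
  toFun x := ⟨x, 0⟩
  map_add' _ _ := by ext <;> simp
  map_smul' _ _ := by ext <;> simp
  map_lie' := by intros; ext <;> simp

/-- The inclusion `x ↦ (x)_ad = (0, x)` of `𝔤_ad` into `𝔤 ⋉ 𝔤_ad`. -/
def ad : 𝔤 →ₗ[ℂ] AdExt 𝔤 where
  toFun x := ⟨0, x⟩
  map_add' _ _ := by ext <;> simp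
  map_smul' _ _ := by ext <;> simp

/-- The endomorphism `(x, y) ↦ (x, 2 y)` of the Lie algebra `𝔤 ⋉ 𝔤_ad`; it multiplies elements of
degree `k` of the enveloping algebra by `2 ^ k`, and serves to separate degrees. -/
def dilate : AdExt 𝔤 →ₗ⁅ℂ⁆ AdExt 𝔤 where
  toFun p := ⟨p.fst, (2 : ℂ) • p.snd⟩
  map_add' _ _ := by ext <;> simp
  map_smul' c p := by
    ext
    · simp
    · exact smul_comm (2 : ℂ) c p.snd
  map_lie' := by intros; ext <;> simp

theorem eq_inl_add_ad (p : AdExt 𝔤) : p = inl p.fst + ad p.snd := by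
  ext
  · exact (add_zero p.fst).symm
  · exact (zero_add p.snd).symm

theorem dilate_inl (x : 𝔤) : dilate (inl x) = inl x := by
  ext
  · rfl
  · exact smul_zero (2 : ℂ)

theorem dilate_ad (x : 𝔤) : dilate (ad x) = (2 : ℂ) • ad x := by
  ext
  · exact (smul_zero (2 : ℂ)).symm
  · rfl

end AdExt

/-! ### The category of graded modules -/

section GradedModules

variable (𝔤 : Type u) [LieRing 𝔤] [LieAlgebra ℂ 𝔤]

/-- A graded `𝔤 ⋉ 𝔤_ad`-module `V = ⨁_{k ≥ 0} V[k]` with `𝔤 V[k] ⊆ V[k]` and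
`𝔤_ad V[k] ⊆ V[k + 1]`; the graded pieces may have infinite dimension. -/
structure GradedLieMod where
  carrier : Type u
  [addCommGroup : AddCommGroup carrier]
  [module : Module ℂ carrier]
  [lieRingModule : LieRingModule (AdExt 𝔤) carrier]
  [lieModule : LieModule ℂ (AdExt 𝔤) carrier]
  /-- The graded pieces `V[k]`. -/
  gr : ℕ → Submodule ℂ carrier
  isInternal : DirectSum.IsInternal gr
  inl_lie_mem : ∀ (x : 𝔤) (k : ℕ) (v : carrier), v ∈ gr k → ⁅AdExt.inl x, v⁆ ∈ gr k
  ad_lie_mem : ∀ (x : 𝔤) (k : ℕ) (v : carrier), v ∈ gr k → ⁅AdExt.ad x, v⁆ ∈ gr (k + 1)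

namespace GradedLieMod

attribute [instance] addCommGroup module lieRingModule lieModule

variable {𝔤}

/-- Morphisms: homomorphisms of `𝔤 ⋉ 𝔤_ad`-modules that preserve the grading. -/
@[ext] structure Hom (V W : GradedLieMod 𝔤) where
  toLieModuleHom : V.carrier →ₗ⁅ℂ, AdExt 𝔤⁆ W.carrier
  map_mem : ∀ (k : ℕ) (v : V.carrier), v ∈ V.gr k → toLieModuleHom v ∈ W.gr k

instance : Category (GradedLieMod 𝔤) where
  Hom := Hom
  id V := ⟨LieModuleHom.id, fun _ _ hv ↦ hv⟩
  comp f g := ⟨g.toLieModuleHom.comp f.toLieModuleHom,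
    fun k v hv ↦ g.map_mem k _ (f.map_mem k v hv)⟩

/-- Each graded piece `V[k]` is a `𝔤`-module. -/
instance (V : GradedLieMod 𝔤) (k : ℕ) : LieRingModule 𝔤 (V.gr k) where
  bracket x v := ⟨⁅AdExt.inl x, (v : V.carrier)⁆, V.inl_lie_mem x k v v.2⟩
  add_lie x y v := Subtype.ext (by simp)
  lie_add x v w := Subtype.ext (by simp)
  leibniz_lie x y v := Subtype.ext (by simp)

instance (V : GradedLieMod 𝔤) (k : ℕ) : LieModule ℂ 𝔤 (V.gr k) where
  smul_lie c x v := Subtype.ext (by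
    change ⁅AdExt.inl (c • x), (v : V.carrier)⁆ = c • ⁅AdExt.inl x, (v : V.carrier)⁆
    simp)
  lie_smul c x v := Subtype.ext (by
    change ⁅AdExt.inl x, c • (v : V.carrier)⁆ = c • ⁅AdExt.inl x, (v : V.carrier)⁆
    simp)

/-- The objects of `𝒢₂` are the graded modules with finite-dimensional graded pieces. -/
def G2 : ObjectProperty (GradedLieMod 𝔤) := fun V ↦ ∀ k, FiniteDimensional ℂ (V.gr k)

/-! #### Grading shift -/

theorem isInternal_shift {M : Type u} [AddCommGroup M] [Module ℂ M] {gr : ℕ → Submodule ℂ M}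
    (h : DirectSum.IsInternal gr) (r : ℕ) :
    DirectSum.IsInternal (fun k ↦ if r ≤ k then gr (k - r) else ⊥) := by
  rw [DirectSum.isInternal_submodule_iff_iSupIndep_and_iSup_eq_top] at h ⊢
  refine ⟨?_, ?_⟩
  · rw [iSupIndep_def] at *
    intro i
    by_cases hi : r ≤ i
    · simp only [hi, if_true]
      refine (h.1 (i - r)).mono_right (iSup₂_le fun j hj ↦ ?_)
      by_cases hj' : r ≤ j
      · simp only [hj', if_true]
        exact le_iSup₂_of_le (j - r) (by omega) le_rfl
      · simp [hj']
    · simp [hi]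
  · rw [eq_top_iff, ← h.2]
    refine iSup_le fun k ↦ le_iSup_of_le (k + r) ?_
    simp

/-- The grading shift `τ_r`: the same module, with `(τ_r V)[k] = V[k - r]` for `k ≥ r` and
`(τ_r V)[k] = 0` for `k < r`. -/
def shiftObj (r : ℕ) (V : GradedLieMod 𝔤) : GradedLieMod 𝔤 where
  carrier := V.carrier
  gr k := if r ≤ k then V.gr (k - r) else ⊥
  isInternal := isInternal_shift V.isInternal r
  inl_lie_mem x k v hv := by
    by_cases hk : r ≤ k
    · simp only [hk, if_true] at hv ⊢
      exact V.inl_lie_mem x _ v hv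
    · simp only [hk, if_false, Submodule.mem_bot] at hv ⊢
      simp [hv]
  ad_lie_mem x k v hv := by
    by_cases hk : r ≤ k
    · have hk' : r ≤ k + 1 := by omega
      simp only [hk, hk', if_true] at hv ⊢
      have := V.ad_lie_mem x _ v hv
      rwa [show k + 1 - r = k - r + 1 by omega]
    · simp only [hk, if_false, Submodule.mem_bot] at hv
      simp [hv]

/-- The grading shift functor `τ_r`. -/
def shift (r : ℕ) : GradedLieMod 𝔤 ⥤ GradedLieMod 𝔤 where
  obj := shiftObj r
  map {V W} f := ⟨f.toLieModuleHom, fun k v hv ↦ by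
    by_cases hk : r ≤ k
    · simp only [shiftObj, hk, if_true] at hv ⊢
      exact f.map_mem _ v hv
    · simp only [shiftObj, hk, if_false] at hv ⊢
      subst hv
      exact map_zero f.toLieModuleHom⟩

/-! #### Graded submodules and quotients -/

/-- The projection of `V` onto its graded piece `V[k]`, as an endomorphism of `V`. -/
def proj (V : GradedLieMod 𝔤) (k : ℕ) (v : V.carrier) : V.carrier :=
  letI := V.isInternal.chooseDecomposition
  (DirectSum.decompose V.gr v k : V.carrier)

theorem proj_add (V : GradedLieMod 𝔤) (k : ℕ) (v w : V.carrier) :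
    V.proj k (v + w) = V.proj k v + V.proj k w := by
  simp [proj, DirectSum.decompose_add]

theorem proj_of_mem (V : GradedLieMod 𝔤) {k : ℕ} {v : V.carrier} (hv : v ∈ V.gr k) :
    V.proj k v = v := by
  let := V.isInternal.chooseDecomposition
  exact DirectSum.decompose_of_mem_same V.gr hv

theorem proj_of_mem_ne (V : GradedLieMod 𝔤) {k l : ℕ} {v : V.carrier} (hv : v ∈ V.gr k)
    (h : k ≠ l) : V.proj l v = 0 := by
  let := V.isInternal.chooseDecomposition
  exact DirectSum.decompose_of_mem_ne V.gr hv h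

/-- A `𝔤 ⋉ 𝔤_ad`-submodule is graded if it contains the homogeneous components of its elements. -/
def IsGraded (V : GradedLieMod 𝔤) (K : LieSubmodule ℂ (AdExt 𝔤) V.carrier) : Prop :=
  ∀ v ∈ K, ∀ k, V.proj k v ∈ K

theorem isGraded_sInf (V : GradedLieMod 𝔤) (S : Set (LieSubmodule ℂ (AdExt 𝔤) V.carrier))
    (hS : ∀ K ∈ S, V.IsGraded K) : V.IsGraded (sInf S) := by
  intro v hv k
  rw [← SetLike.mem_coe, LieSubmodule.coe_sInf, Set.mem_iInter₂] at hv ⊢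
  exact fun K hK ↦ hS K hK v (hv K hK) k

theorem isInternal_quotient (V : GradedLieMod 𝔤) (K : LieSubmodule ℂ (AdExt 𝔤) V.carrier)
    (hK : V.IsGraded K) : DirectSum.IsInternal
      (fun k ↦ (V.gr k).map (LieSubmodule.Quotient.mk' K : V.carrier →ₗ[ℂ] V.carrier ⧸ K)) := by
  have hV := V.isInternal
  rw [DirectSum.isInternal_submodule_iff_iSupIndep_and_iSup_eq_top] at hV ⊢
  refine ⟨?_, ?_⟩
  · rw [iSupIndep_def]
    intro i
    rw [Submodule.disjoint_def]
    rintro x ⟨v, hv, rfl⟩ hx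
    simp only [← Submodule.map_iSup] at hx
    obtain ⟨w, hw, hwv⟩ := hx
    have h0 : V.proj i w = 0 := by
      refine Submodule.iSup_induction (fun j : ℕ ↦ ⨆ (_ : j ≠ i), V.gr j)
        (motive := fun w ↦ V.proj i w = 0) hw ?_ ?_ ?_
      · intro j x hx
        by_cases hj : j = i
        · have : x = 0 := by simpa [hj] using hx
          subst this
          exact V.proj_of_mem_ne (k := i + 1) (Submodule.zero_mem _) (by omega)
        · exact V.proj_of_mem_ne (k := j) (by simpa [hj] using hx) hj
      · exact V.proj_of_mem_ne (k := i + 1) (Submodule.zero_mem _) (by omega)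
      · intro x y hx hy
        rw [proj_add, hx, hy, add_zero]
    have hmem : v - w ∈ K := by
      have : (LieSubmodule.Quotient.mk (v - w) : V.carrier ⧸ K) = 0 := by
        have h := hwv.symm
        exact (map_sub (LieSubmodule.Quotient.mk' K) v w).trans (sub_eq_zero.mpr h)
      exact (LieSubmodule.Quotient.mk_eq_zero').mp this
    have h1 := hK _ hmem i
    have h2 : V.proj i (v - w) + V.proj i w = V.proj i v := by
      rw [← proj_add, sub_add_cancel]
    rw [h0, add_zero, V.proj_of_mem hv] at h2
    rw [h2] at h1
    exact (LieSubmodule.Quotient.mk_eq_zero').mpr h1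
  · rw [← Submodule.map_iSup, hV.2, Submodule.map_top]
    exact LinearMap.range_eq_top.mpr (LieSubmodule.Quotient.surjective_mk' K)

/-- The quotient of a graded module by a graded submodule, with `(V/K)[k]` the image of `V[k]`. -/
def quotient (V : GradedLieMod 𝔤) (K : LieSubmodule ℂ (AdExt 𝔤) V.carrier)
    (hK : V.IsGraded K) : GradedLieMod 𝔤 where
  carrier := V.carrier ⧸ K
  gr k := (V.gr k).map (LieSubmodule.Quotient.mk' K : V.carrier →ₗ[ℂ] V.carrier ⧸ K)
  isInternal := V.isInternal_quotient K hK
  inl_lie_mem := by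
    rintro x k _ ⟨v, hv, rfl⟩
    exact ⟨_, V.inl_lie_mem x k v hv, LieModuleHom.map_lie (LieSubmodule.Quotient.mk' K) _ _⟩
  ad_lie_mem := by
    rintro x k _ ⟨v, hv, rfl⟩
    exact ⟨_, V.ad_lie_mem x k v hv, LieModuleHom.map_lie (LieSubmodule.Quotient.mk' K) _ _⟩

end GradedLieMod

end GradedModules

/-! ### Modules over enveloping algebras and induced modules -/

/-- The universal enveloping algebra over `ℂ`. -/
abbrev UEnv (L : Type u) [LieRing L] [LieAlgebra ℂ L] : Type u := UniversalEnvelopingAlgebra ℂ L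

namespace UEnv

section

attribute [local instance 100] LieRing.ofAssociativeRing

variable {L : Type u} [LieRing L] [LieAlgebra ℂ L]

/-- The canonical map of a Lie algebra to its enveloping algebra. -/
def ι : L →ₗ[ℂ] UEnv L := (UniversalEnvelopingAlgebra.ι ℂ : L →ₗ⁅ℂ⁆ UEnv L).toLinearMap

theorem ι_lie (x y : L) : ι ⁅x, y⁆ = ι x * ι y - ι y * ι x :=
  (LieHom.map_lie (UniversalEnvelopingAlgebra.ι ℂ : L →ₗ⁅ℂ⁆ UEnv L) x y).trans
    (LieRing.of_associative_ring_bracket _ _)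

/-- The homomorphism of enveloping algebras induced by a homomorphism of Lie algebras. -/
def map {L' : Type u} [LieRing L'] [LieAlgebra ℂ L'] (f : L →ₗ⁅ℂ⁆ L') : UEnv L →ₐ[ℂ] UEnv L' :=
  UniversalEnvelopingAlgebra.lift ℂ ((UniversalEnvelopingAlgebra.ι ℂ : L' →ₗ⁅ℂ⁆ UEnv L').comp f)

theorem map_ι {L' : Type u} [LieRing L'] [LieAlgebra ℂ L'] (f : L →ₗ⁅ℂ⁆ L') (x : L) :
    map f (ι x) = ι (f x) :=
  UniversalEnvelopingAlgebra.lift_ι_apply ℂ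
    ((UniversalEnvelopingAlgebra.ι ℂ : L' →ₗ⁅ℂ⁆ UEnv L').comp f) x

/-- A subspace of the enveloping algebra that contains `1` and is stable under left multiplication
by the Lie algebra is everything. -/
theorem eq_top_of_one_mem (S : Submodule ℂ (UEnv L)) (h1 : 1 ∈ S)
    (hS : ∀ (x : L), ∀ u ∈ S, ι x * u ∈ S) : S = ⊤ := by
  let T : Subalgebra ℂ (UEnv L) :=
    { carrier := {u | ∀ s ∈ S, u * s ∈ S}
      mul_mem' := fun {a b} ha hb s hs ↦ by rw [mul_assoc]; exact ha _ (hb s hs)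
      add_mem' := fun {a b} ha hb s hs ↦ by rw [add_mul]; exact S.add_mem (ha s hs) (hb s hs)
      algebraMap_mem' := fun c s hs ↦ by
        rw [← Algebra.smul_def]
        exact S.smul_mem c hs }
  let f : L →ₗ⁅ℂ⁆ T :=
    { toFun := fun x ↦ ⟨ι x, hS x⟩
      map_add' := fun x y ↦ Subtype.ext (map_add ι x y)
      map_smul' := fun c x ↦ Subtype.ext (map_smul ι c x)
      map_lie' := fun {x y} ↦ Subtype.ext (ι_lie x y) }
  have key : T.val.comp (UniversalEnvelopingAlgebra.lift ℂ f) = AlgHom.id ℂ (UEnv L) := by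
    apply UniversalEnvelopingAlgebra.hom_ext
    ext x
    change ((UniversalEnvelopingAlgebra.lift ℂ f (UniversalEnvelopingAlgebra.ι ℂ x) : T) : UEnv L)
      = UniversalEnvelopingAlgebra.ι ℂ x
    rw [UniversalEnvelopingAlgebra.lift_ι_apply]
    rfl
  rw [eq_top_iff]
  intro u _
  have hu : u ∈ T := by
    have := DFunLike.congr_fun key u
    rw [← show _ = u from this]
    exact (UniversalEnvelopingAlgebra.lift ℂ f u).2
  simpa using hu 1 h1

end

variable {L : Type u} [LieRing L] [LieAlgebra ℂ L]

/-- A module over the enveloping algebra is a module over the Lie algebra. -/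
abbrev lieRingModule (M : Type u) [AddCommGroup M] [Module (UEnv L) M] : LieRingModule L M where
  bracket x m := ι x • m
  add_lie x y m := by
    rw [map_add, add_smul]
  lie_add x m n := smul_add _ _ _
  leibniz_lie x y m := by
    change ι x • ι y • m = ι ⁅x, y⁆ • m + ι y • ι x • m
    rw [ι_lie, sub_smul, mul_smul, mul_smul, sub_add_cancel]

theorem lieModule (M : Type u) [AddCommGroup M] [Module ℂ M] [Module (UEnv L) M]
    [IsScalarTower ℂ (UEnv L) M] : letI := lieRingModule (L := L) M; LieModule ℂ L M :=
  letI := lieRingModule (L := L) M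
  { smul_lie := fun c x m ↦ by
      change ι (c • x) • m = c • ι x • m
      rw [map_smul, smul_assoc]
    lie_smul := fun c x m ↦ by
      change ι x • c • m = c • ι x • m
      rw [← algebraMap_smul (UEnv L) c m, ← algebraMap_smul (UEnv L) c (ι x • m),
        ← mul_smul, ← mul_smul, Algebra.commutes] }

end UEnv

section Induced

variable {𝔤 : Type u} [LieRing 𝔤] [LieAlgebra ℂ 𝔤]

/-- Products of elements of `𝔤` and `𝔤_ad` in `U(𝔤 ⋉ 𝔤_ad)` with exactly `k` factors
from `𝔤_ad`. -/
inductive IsMonomial : ℕ → UEnv (AdExt 𝔤) → Prop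
  | one : IsMonomial 0 1
  | inl_mul (x : 𝔤) {k : ℕ} {u : UEnv (AdExt 𝔤)} :
      IsMonomial k u → IsMonomial k (UEnv.ι (AdExt.inl x) * u)
  | ad_mul (x : 𝔤) {k : ℕ} {u : UEnv (AdExt 𝔤)} :
      IsMonomial k u → IsMonomial (k + 1) (UEnv.ι (AdExt.ad x) * u)

variable (V : Type u) [AddCommGroup V] [Module ℂ V] [Module (UEnv 𝔤) V]
  [IsScalarTower ℂ (UEnv 𝔤) V]

/-- The relations `(u a) ⊗ v = u ⊗ (a v)`, `a ∈ U(𝔤)`, of the tensor product over `U(𝔤)`. -/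
def balancedRel : Submodule (UEnv (AdExt 𝔤)) (UEnv (AdExt 𝔤) ⊗[ℂ] V) :=
  Submodule.span _ {t | ∃ (u : UEnv (AdExt 𝔤)) (a : UEnv 𝔤) (v : V),
    t = (u * UEnv.map AdExt.inl a) ⊗ₜ[ℂ] v - u ⊗ₜ[ℂ] (a • v)}

/-- The induced module `U(𝔤 ⋉ 𝔤_ad) ⊗_{U(𝔤)} V`. -/
def Induced : Type u := (UEnv (AdExt 𝔤) ⊗[ℂ] V) ⧸ balancedRel V

namespace Induced

instance : AddCommGroup (Induced (𝔤 := 𝔤) V) :=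
  inferInstanceAs (AddCommGroup ((UEnv (AdExt 𝔤) ⊗[ℂ] V) ⧸ balancedRel V))

instance : Module (UEnv (AdExt 𝔤)) (Induced (𝔤 := 𝔤) V) :=
  inferInstanceAs (Module (UEnv (AdExt 𝔤)) ((UEnv (AdExt 𝔤) ⊗[ℂ] V) ⧸ balancedRel V))

instance : Module ℂ (Induced (𝔤 := 𝔤) V) :=
  inferInstanceAs (Module ℂ ((UEnv (AdExt 𝔤) ⊗[ℂ] V) ⧸ balancedRel V))

instance : IsScalarTower ℂ (UEnv (AdExt 𝔤)) (Induced (𝔤 := 𝔤) V) :=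
  inferInstanceAs (IsScalarTower ℂ (UEnv (AdExt 𝔤)) ((UEnv (AdExt 𝔤) ⊗[ℂ] V) ⧸ balancedRel V))

instance : LieRingModule (AdExt 𝔤) (Induced (𝔤 := 𝔤) V) := UEnv.lieRingModule _

instance : LieModule ℂ (AdExt 𝔤) (Induced (𝔤 := 𝔤) V) := UEnv.lieModule _

variable {V}

/-- The class of `u ⊗ v` in `U(𝔤 ⋉ 𝔤_ad) ⊗_{U(𝔤)} V`. -/
def tmul (u : UEnv (AdExt 𝔤)) (v : V) : Induced (𝔤 := 𝔤) V :=
  (balancedRel (𝔤 := 𝔤) V).mkQ (u ⊗ₜ[ℂ] v)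

theorem smul_tmul (w u : UEnv (AdExt 𝔤)) (v : V) : w • tmul u v = tmul (w * u) v := rfl

theorem lie_tmul (x : AdExt 𝔤) (u : UEnv (AdExt 𝔤)) (v : V) :
    ⁅x, tmul u v⁆ = tmul (UEnv.ι x * u) v := rfl

variable (V)

/-- The linear map `u ⊗ v ↦ tmul u v`. -/
def tmulₗ : UEnv (AdExt 𝔤) ⊗[ℂ] V →ₗ[ℂ] Induced (𝔤 := 𝔤) V :=
  ((balancedRel (𝔤 := 𝔤) V).mkQ).restrictScalars ℂ

theorem tmulₗ_surjective : Function.Surjective (tmulₗ (𝔤 := 𝔤) V) :=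
  (balancedRel (𝔤 := 𝔤) V).mkQ_surjective

/-- The degree `k` part of the induced module when `V` is placed in degree `r`. -/
def piece (r k : ℕ) : Submodule ℂ (Induced (𝔤 := 𝔤) V) :=
  Submodule.span ℂ {t | ∃ (a : ℕ) (u : UEnv (AdExt 𝔤)) (v : V),
    r + a = k ∧ IsMonomial a u ∧ t = tmul u v}

theorem inl_lie_mem (r : ℕ) (x : 𝔤) (k : ℕ) (t : Induced (𝔤 := 𝔤) V) (ht : t ∈ piece V r k) :
    ⁅AdExt.inl x, t⁆ ∈ piece V r k := by
  induction ht using Submodule.span_induction with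
  | mem t ht =>
    obtain ⟨a, u, v, h, hu, rfl⟩ := ht
    exact Submodule.subset_span ⟨a, _, v, h, hu.inl_mul x, lie_tmul _ _ _⟩
  | zero => simp
  | add s t _ _ hs ht => rw [lie_add]; exact add_mem hs ht
  | smul c t _ ht => rw [lie_smul]; exact Submodule.smul_mem _ c ht

theorem ad_lie_mem (r : ℕ) (x : 𝔤) (k : ℕ) (t : Induced (𝔤 := 𝔤) V) (ht : t ∈ piece V r k) :
    ⁅AdExt.ad x, t⁆ ∈ piece V r (k + 1) := by
  induction ht using Submodule.span_induction with
  | mem t ht =>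
    obtain ⟨a, u, v, h, hu, rfl⟩ := ht
    exact Submodule.subset_span ⟨a + 1, _, v, by omega, hu.ad_mul x, lie_tmul _ _ _⟩
  | zero => simp
  | add s t _ _ hs ht => rw [lie_add]; exact add_mem hs ht
  | smul c t _ ht => rw [lie_smul]; exact Submodule.smul_mem _ c ht

theorem iSup_piece (r : ℕ) : ⨆ k, piece (𝔤 := 𝔤) V r k = ⊤ := by
  set N := ⨆ k, piece (𝔤 := 𝔤) V r k with hN
  have hlie : ∀ (x : AdExt 𝔤), ∀ t ∈ N, ⁅x, t⁆ ∈ N := by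
    intro x t ht
    refine Submodule.iSup_induction (fun k ↦ piece (𝔤 := 𝔤) V r k)
      (motive := fun t ↦ ⁅x, t⁆ ∈ N) ht ?_ ?_ ?_
    · intro k t ht
      rw [AdExt.eq_inl_add_ad x, add_lie]
      exact add_mem (Submodule.mem_iSup_of_mem k (inl_lie_mem V r _ k t ht))
        (Submodule.mem_iSup_of_mem (k + 1) (ad_lie_mem V r _ k t ht))
    · simp
    · intro s t hs ht
      rw [lie_add]
      exact add_mem hs ht
  have key : ∀ (u : UEnv (AdExt 𝔤)) (v : V), tmul u v ∈ N := by
    intro u v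
    let f : UEnv (AdExt 𝔤) →ₗ[ℂ] Induced (𝔤 := 𝔤) V :=
      (tmulₗ V).comp ((TensorProduct.mk ℂ (UEnv (AdExt 𝔤)) V).flip v)
    have hf : N.comap f = ⊤ := by
      apply UEnv.eq_top_of_one_mem
      · exact Submodule.mem_iSup_of_mem r
          (Submodule.subset_span ⟨0, 1, v, by omega, IsMonomial.one, rfl⟩)
      · intro x u hu
        exact hlie x _ hu
    have : u ∈ N.comap f := by rw [hf]; trivial
    exact this
  rw [eq_top_iff]
  intro t _
  obtain ⟨t, rfl⟩ := tmulₗ_surjective V t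
  induction t with
  | zero => simp
  | tmul u v => exact key u v
  | add s t hs ht => rw [map_add]; exact add_mem (hs trivial) (ht trivial)

/-- The linear endomorphism of the induced module that is induced by `AdExt.dilate`. -/
theorem exists_dilate : ∃ S : Module.End ℂ (Induced (𝔤 := 𝔤) V),
    ∀ (u : UEnv (AdExt 𝔤)) (v : V), S (tmul u v) = tmul (UEnv.map AdExt.dilate u) v := by
  let F : UEnv (AdExt 𝔤) ⊗[ℂ] V →ₗ[ℂ] UEnv (AdExt 𝔤) ⊗[ℂ] V :=
    TensorProduct.map (UEnv.map (AdExt.dilate (𝔤 := 𝔤))).toLinearMap LinearMap.id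
  have hF : ∀ (w : UEnv (AdExt 𝔤)) (t : UEnv (AdExt 𝔤) ⊗[ℂ] V),
      F (w • t) = UEnv.map AdExt.dilate w • F t := by
    intro w t
    induction t with
    | zero => simp
    | tmul u v =>
      change F ((w * u) ⊗ₜ v) = (UEnv.map AdExt.dilate w * UEnv.map AdExt.dilate u) ⊗ₜ v
      rw [← map_mul]
      rfl
    | add s t hs ht => rw [smul_add, map_add, hs, ht, map_add, smul_add]
  have hinl : ∀ a : UEnv 𝔤,
      UEnv.map AdExt.dilate (UEnv.map AdExt.inl a) = UEnv.map AdExt.inl a := by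
    intro a
    let T : Submodule ℂ (UEnv 𝔤) := LinearMap.eqLocus
      ((UEnv.map (AdExt.dilate (𝔤 := 𝔤))).toLinearMap.comp
        (UEnv.map (AdExt.inl (𝔤 := 𝔤))).toLinearMap) (UEnv.map (AdExt.inl (𝔤 := 𝔤))).toLinearMap
    have hT : T = ⊤ := by
      apply UEnv.eq_top_of_one_mem
      · change UEnv.map AdExt.dilate (UEnv.map AdExt.inl 1) = UEnv.map AdExt.inl 1
        simp
      · intro x u hu
        change UEnv.map AdExt.dilate (UEnv.map AdExt.inl (UEnv.ι x * u)) =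
          UEnv.map AdExt.inl (UEnv.ι x * u)
        have hu' : UEnv.map AdExt.dilate (UEnv.map AdExt.inl u) = UEnv.map AdExt.inl u := hu
        rw [map_mul, map_mul, hu', UEnv.map_ι, UEnv.map_ι, AdExt.dilate_inl]
    have : a ∈ T := by rw [hT]; trivial
    exact this
  let J := (balancedRel (𝔤 := 𝔤) V).restrictScalars ℂ
  have hJ : ∀ t ∈ balancedRel (𝔤 := 𝔤) V, F t ∈ balancedRel (𝔤 := 𝔤) V := by
    intro t ht
    induction ht using Submodule.span_induction with
    | mem t ht =>
      obtain ⟨u, a, v, rfl⟩ := ht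
      refine Submodule.subset_span ⟨UEnv.map AdExt.dilate u, a, v, ?_⟩
      rw [map_sub]
      change (UEnv.map AdExt.dilate (u * UEnv.map AdExt.inl a)) ⊗ₜ[ℂ] v - _ = _
      rw [map_mul, hinl]
      rfl
    | zero => simp
    | add s t _ _ hs ht => rw [map_add]; exact add_mem hs ht
    | smul w t _ ht => rw [hF]; exact Submodule.smul_mem _ _ ht
  exact ⟨J.mapQ J F hJ, fun u v ↦ rfl⟩

theorem map_dilate_of_isMonomial {k : ℕ} {u : UEnv (AdExt 𝔤)} (hu : IsMonomial k u) :
    UEnv.map AdExt.dilate u = (2 : ℂ) ^ k • u := by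
  induction hu with
  | one => simp
  | inl_mul x _ ih => rw [map_mul, ih, UEnv.map_ι, AdExt.dilate_inl, mul_smul_comm]
  | ad_mul x _ ih =>
    rw [map_mul, ih, UEnv.map_ι, AdExt.dilate_ad, mul_smul_comm, map_smul, smul_mul_assoc,
      smul_smul, pow_succ]

theorem isInternal_piece (r : ℕ) : DirectSum.IsInternal (piece (𝔤 := 𝔤) V r) := by
  refine DirectSum.isInternal_submodule_of_iSupIndep_of_iSup_eq_top ?_ (iSup_piece V r)
  obtain ⟨S, hS⟩ := exists_dilate (𝔤 := 𝔤) V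
  have hinj : Function.Injective (fun k : ℕ ↦ (2 : ℂ) ^ k) := by
    intro a b hab
    have h : ((2 ^ a : ℕ) : ℂ) = ((2 ^ b : ℕ) : ℂ) := by push_cast; exact hab
    exact Nat.pow_right_injective le_rfl (Nat.cast_injective h)
  have hmap : ∀ (k : ℕ), piece (𝔤 := 𝔤) V r k ≤
      (S.eigenspace ((2 : ℂ) ^ (k - r)) : Submodule ℂ (Induced (𝔤 := 𝔤) V)) := by
    intro k
    refine Submodule.span_le.mpr ?_
    rintro _ ⟨a, u, v, rfl, hu, rfl⟩
    rw [SetLike.mem_coe, Module.End.mem_eigenspace_iff, hS, map_dilate_of_isMonomial hu,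
      Nat.add_sub_cancel_left]
    rfl
  have hbot : ∀ k, k < r → piece (𝔤 := 𝔤) V r k = ⊥ := by
    intro k hk
    rw [piece, Submodule.span_eq_bot]
    rintro _ ⟨a, u, v, h, _⟩
    omega
  have h0 : iSupIndep fun k : ℕ ↦
      (S.eigenspace ((2 : ℂ) ^ k) : Submodule ℂ (Induced (𝔤 := 𝔤) V)) :=
    S.eigenspaces_iSupIndep.comp hinj
  rw [iSupIndep_def] at h0 ⊢
  intro i
  by_cases hi : i < r
  · rw [hbot i hi]; exact disjoint_bot_left
  · refine (h0 (i - r)).mono (hmap i) (iSup₂_le fun j hj ↦ ?_)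
    by_cases hj' : j < r
    · rw [hbot j hj']; exact bot_le
    · exact le_iSup₂_of_le (j - r) (by omega) (hmap j)

/-- The induced module `U(𝔤 ⋉ 𝔤_ad) ⊗_{U(𝔤)} ev_r V`, as a graded module: `V` is placed in
degree `r`, and elements of `𝔤_ad` have degree one. -/
def graded (r : ℕ) : GradedLieMod 𝔤 where
  carrier := Induced (𝔤 := 𝔤) V
  gr := piece V r
  isInternal := isInternal_piece V r
  inl_lie_mem := inl_lie_mem V r
  ad_lie_mem := ad_lie_mem V r

end Induced

end Induced

/-! ### Weights and simple modules -/

section Weights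

open LieAlgebra LieAlgebra.IsKilling

variable {𝔤 : Type u} [LieRing 𝔤] [LieAlgebra ℂ 𝔤] [FiniteDimensional ℂ 𝔤]
  [LieAlgebra.IsSimple ℂ 𝔤] {𝔥 : LieSubalgebra ℂ 𝔤} [𝔥.IsCartanSubalgebra]

/-- The bilinear form on `𝔥^*` that corresponds to the restriction of the Killing form to `𝔥`. -/
def dualForm (α β : Module.Dual ℂ 𝔥) : ℂ :=
  killingForm ℂ 𝔤 ((cartanEquivDual 𝔥).symm α : 𝔥) ((cartanEquivDual 𝔥).symm β : 𝔥)

/-- Dominant integral weights: `P⁺ = {lam ∈ 𝔥^* : lam (h_i) ∈ ℤ_{≥ 0} for all i}`, where the `h_i`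
are the simple coroots. -/
def DominantWeight (b : (rootSystem 𝔥).Base) : Type u :=
  {lam : Module.Dual ℂ 𝔥 // ∀ i ∈ b.support, ∃ n : ℕ, lam ((rootSystem 𝔥).coroot i) = n}

variable {b : (rootSystem 𝔥).Base}

/-- The set `R⁺ = R ∩ Q⁺` of positive roots. -/
def positiveRoots (b : (rootSystem 𝔥).Base) : Set 𝔥.root :=
  {α | (rootSystem 𝔥).root α ∈ AddSubmonoid.closure ((rootSystem 𝔥).root '' b.support)}

/-- The set `{α ∈ R : (α, ξ) = max_{β ∈ R} (β, ξ)}`; the numbers `(β, ξ)` are real. -/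
def maximalRoots (ξ : DominantWeight b) : Set 𝔥.root :=
  {α | ∀ β : 𝔥.root, (dualForm ((rootSystem 𝔥).root β) ξ.1).re ≤
    (dualForm ((rootSystem 𝔥).root α) ξ.1).re}

/-- The set `Γ(lam, S)` of the pairs `(μ, r)` with `μ = lam - ∑_{β ∈ S} n_β β` and
`∑_{β ∈ S} n_β = r` for some `n_β ∈ ℤ_{≥ 0}`. -/
def GammaSet (lam : DominantWeight b) (S : Set 𝔥.root) : Set (DominantWeight b × ℕ) :=
  {p | ∃ n : 𝔥.root → ℕ, (∀ β ∉ S, n β = 0) ∧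
    p.1.1 = lam.1 - ∑ β, n β • (rootSystem 𝔥).root β ∧ ∑ β, n β = p.2}

/-- The left ideal of `U(𝔤)` generated by the defining relations of `V(lam)`: `h - lam(h)` for
`h ∈ 𝔥`, the root vectors of the simple roots `α_i`, and `y ^ (lam(h_i) + 1)` for the root
vectors `y` of the roots `-α_i`. -/
def simpleModuleRel (lam : DominantWeight b) : Submodule (UEnv 𝔤) (UEnv 𝔤) :=
  Submodule.span (UEnv 𝔤)
    ({a | ∃ h : 𝔥, a = UEnv.ι (h : 𝔤) - algebraMap ℂ (UEnv 𝔤) (lam.1 h)} ∪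
     {a | ∃ i ∈ b.support, ∃ x ∈ rootSpace 𝔥 (i.1 : 𝔥 → ℂ), a = UEnv.ι x} ∪
     {a | ∃ i ∈ b.support, ∃ y ∈ rootSpace 𝔥 (-(i.1 : 𝔥 → ℂ)), ∃ n : ℕ,
       lam.1 ((rootSystem 𝔥).coroot i) = n ∧ a = UEnv.ι y ^ (n + 1)})

/-- The simple `𝔤`-module `V(lam)`, as the `U(𝔤)`-module generated by one element subject to the
defining relations. -/
def SimpleModule (lam : DominantWeight b) : Type u := UEnv 𝔤 ⧸ simpleModuleRel lam

namespace SimpleModule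

variable (lam : DominantWeight b)

instance : AddCommGroup (SimpleModule lam) :=
  inferInstanceAs (AddCommGroup (UEnv 𝔤 ⧸ simpleModuleRel lam))

instance : Module (UEnv 𝔤) (SimpleModule lam) :=
  inferInstanceAs (Module (UEnv 𝔤) (UEnv 𝔤 ⧸ simpleModuleRel lam))

instance : Module ℂ (SimpleModule lam) :=
  inferInstanceAs (Module ℂ (UEnv 𝔤 ⧸ simpleModuleRel lam))

instance : IsScalarTower ℂ (UEnv 𝔤) (SimpleModule lam) :=
  inferInstanceAs (IsScalarTower ℂ (UEnv 𝔤) (UEnv 𝔤 ⧸ simpleModuleRel lam))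

instance : LieRingModule 𝔤 (SimpleModule lam) := UEnv.lieRingModule _

instance : LieModule ℂ 𝔤 (SimpleModule lam) := UEnv.lieModule _

end SimpleModule

/-- The multiplicity `[V : ev_r V(lam)] = dim Hom_𝔤(V(lam), V[r])`. -/
def simpleMultiplicity (V : GradedLieMod 𝔤) (p : DominantWeight b × ℕ) : Cardinal.{u} :=
  Module.rank ℂ (SimpleModule p.1 →ₗ⁅ℂ, 𝔤⁆ V.gr p.2)

/-- The objects of the full subcategory `𝒢₂[Γ]`: those objects `V` of `𝒢₂` for which
`[V : ev_r V(lam)] ≠ 0` implies `(lam, r) ∈ Γ`. -/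
def G2Gamma (Γ : Set (DominantWeight b × ℕ)) : ObjectProperty (GradedLieMod 𝔤) :=
  fun V ↦ GradedLieMod.G2 V ∧ ∀ p : DominantWeight b × ℕ, simpleMultiplicity V p ≠ 0 → p ∈ Γ

/-- The graded submodules `K` of `V` such that `V / K` lies in `𝒢₂[Γ]`. -/
def truncationKernels (Γ : Set (DominantWeight b × ℕ)) (V : GradedLieMod 𝔤) :
    Set (LieSubmodule ℂ (AdExt 𝔤) V.carrier) :=
  {K | ∃ hK : V.IsGraded K, G2Gamma Γ (V.quotient K hK)}

/-- The maximal quotient `V^Γ` of `V` that lies in `𝒢₂[Γ]`: the quotient by the intersection of all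
graded submodules `K` such that `V / K` lies in `𝒢₂[Γ]`. -/
def truncation (Γ : Set (DominantWeight b × ℕ)) (V : GradedLieMod 𝔤) : GradedLieMod 𝔤 :=
  V.quotient (sInf (truncationKernels Γ V)) (V.isGraded_sInf _ fun _ hK ↦ hK.1)

/-- `P(lam, r) = U(𝔤 ⋉ 𝔤_ad) ⊗_{U(𝔤)} ev_r V(lam)`. -/
def projectiveModule (lam : DominantWeight b) (r : ℕ) : GradedLieMod 𝔤 :=
  Induced.graded (SimpleModule lam) r

end Weights

end

/-! Since `τ_r` commutes with truncation and `P(μ, r) = τ_r P(μ, 0)`, it suffices that `P(μ, 0)` has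
the same truncation with respect to `Γ(μ, Ψ)` as with respect to `{(ν, s) | (ν, s + r) ∈ Γ(λ, Ψ)}`.
The former set is contained in the latter, so let `Q` be a graded quotient of `P(μ, 0)` whose
singular weights are allowed by the latter.

Let `m` be the common value `(β, ξ)`, `β ∈ Ψ`; it is positive because `Ψ ⊆ R⁺`. Every singular
weight of `Q[s]` pairs with `ξ` to `(μ, ξ) - s m`, and every weight lies below a singular one, so
its pairing is at most that. If `a ∈ Q[s]` attains this bound, then `(x_γ)_ad a = 0` for each weight
`γ` of `𝔤` with `(γ, ξ) > -m`, that is, unless `-γ ∈ Ψ`. By induction `Q[s]` is generated over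
`U(𝔫⁻)` by the vectors that are obtained from `v_μ` by applying `(x_{-β})_ad` for `s` roots `β ∈ Ψ`.
The weights of these are the `μ - ∑ n_β β` with `∑ n_β = s`, and a weight of a singular vector of
a finite-dimensional module is the weight of some element of each generating set over `U(𝔫⁻)`.

The truncations are well defined because all proper submodules of finite codimension in a highest
weight module coincide. -/

noncomputable section

/-! ### Generation by simple root spaces -/

section Generation

open LieAlgebra LieAlgebra.IsKilling LieModule

variable {K L : Type*} [Field K] [LieRing L] [LieAlgebra K L] [FiniteDimensional K L]
  {H : LieSubalgebra K L} [H.IsCartanSubalgebra] [IsTriangularizable K H L]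

theorem eq_top_of_cartan_le_of_rootSpace_le (S : Submodule K L) (hH : ∀ h : H, (h : L) ∈ S)
    (hS : ∀ α : H.root, ∀ x ∈ rootSpace H (α.1 : H → K), x ∈ S) : S = ⊤ := by
  have htop := congrArg LieSubmodule.toSubmodule (iSup_genWeightSpace_eq_top' K H L)
  rw [LieSubmodule.iSup_toSubmodule, LieSubmodule.top_toSubmodule] at htop
  refine eq_top_iff.mpr (htop ▸ iSup_le fun χ x hx ↦ ?_)
  by_cases hχ : χ.IsZero
  · have hx0 : x ∈ (rootSpace H (0 : H → K)).toSubmodule := by rwa [hχ.eq] at hx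
    rw [rootSpace_zero_eq] at hx0
    exact hH ⟨x, hx0⟩
  · exact hS ⟨χ, by simpa using hχ⟩ x hx

variable [CharZero K] [IsKilling K L]

/- Apply `e`, a root vector for `α`, to the first vector of the `α`-string through `β` that lies
strictly below `γ = α + β`, counting down from the top of the string: representation theory of
`𝔰𝔩₂` says that the result is nonzero. -/
theorem exists_lie_ne_zero_of_eq_add {α β γ : Weight K H L} (hα : α.IsNonZero)
    (h : (γ : H → K) = α + β) :
    ∃ e ∈ rootSpace H α, ∃ x ∈ rootSpace H β, ⁅e, x⁆ ≠ 0 := by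
  have hk : 1 ≤ chainTopCoeff α β := by
    have hbot : rootSpace H ((1 : ℤ) • (α : H → K) + β) ≠ ⊥ := by
      rw [one_smul, ← h]
      exact γ.genWeightSpace_ne_bot
    exact_mod_cast ((rootSpace_zsmul_add_ne_bot_iff α β hα 1).mp hbot).1
  obtain ⟨k, hk⟩ := Nat.exists_eq_add_of_le' hk
  obtain ⟨x, hx, hx0⟩ := (chainTop α β).exists_ne_zero
  obtain ⟨h', e, f, isSl2, he, hf⟩ := exists_isSl2Triple_of_weight_isNonZero hα
  obtain rfl := isSl2.h_eq_coroot hα he hf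
  have prim : isSl2.HasPrimitiveVectorWith x (chainLength α β : K) := by
    refine ⟨hx0, (chainLength_smul _ _ hx).symm, ?_⟩
    have hex := lie_mem_genWeightSpace_of_mem_genWeightSpace he hx
    rwa [genWeightSpace_add_chainTop _ _ hα] at hex
  have hlt : k < chainLength α β :=
    Nat.lt_of_succ_le (hk.symm.trans_le (chainTopCoeff_le_chainLength α β))
  refine ⟨e, he, (toEnd K L L f ^ (k + 1)) x, ?_, ?_⟩
  · have hfx := toEnd_pow_apply_mem hf hx (k + 1)
    rwa [coe_chainTop, hk, show (k + 1) • (-(α : H → K)) + (((k + 1 : ℕ) : ℤ) • (α : H → K) + β)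
      = β by module] at hfx
  · rw [prim.lie_e_pow_succ_toEnd_f k]
    refine smul_ne_zero (mul_ne_zero (by exact_mod_cast k.succ_ne_zero) (sub_ne_zero.mpr ?_))
      (prim.pow_toEnd_f_ne_zero_of_eq_nat rfl hlt.le)
    exact_mod_cast hlt.ne'

theorem mem_of_mem_rootSpace_of_eq_add (S : LieSubalgebra K L) {α β γ : Weight K H L}
    (hα : α.IsNonZero) (hγ : γ.IsNonZero) (h : (γ : H → K) = α + β)
    (hαS : ∀ x ∈ rootSpace H α, x ∈ S) (hβS : ∀ x ∈ rootSpace H β, x ∈ S) :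
    ∀ x ∈ rootSpace H γ, x ∈ S := by
  intro y hy
  obtain ⟨e, he, x, hx, hex⟩ := exists_lie_ne_zero_of_eq_add hα h
  have hmem : ⁅e, x⁆ ∈ rootSpace H γ := h ▸ lie_mem_genWeightSpace_of_mem_genWeightSpace he hx
  obtain ⟨c, hc⟩ := (finrank_eq_one_iff_of_nonzero' (⟨⁅e, x⁆, hmem⟩ : rootSpace H γ)
    (by simpa using hex)).mp (finrank_rootSpace_eq_one _ hγ) ⟨y, hy⟩
  rw [show y = c • ⁅e, x⁆ from (congrArg Subtype.val hc).symm]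
  exact S.smul_mem c (S.lie_mem (hαS e he) (hβS x hx))

section Base

variable (b : (rootSystem H).Base)

theorem mem_of_mem_rootSpace_of_isPos (S : LieSubalgebra K L)
    (hS : ∀ i ∈ b.support, ∀ x ∈ rootSpace H (i.1 : H → K), x ∈ S) {α : H.root}
    (hα : b.IsPos α) : ∀ x ∈ rootSpace H (α.1 : H → K), x ∈ S := by
  refine hα.induction_on_add (p := fun α ↦ ∀ x ∈ rootSpace H (α.1 : H → K), x ∈ S) hS ?_
  intro i j k hk hi hj
  refine mem_of_mem_rootSpace_of_eq_add S (LieSubalgebra.isNonZero_coe_root j)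
    (LieSubalgebra.isNonZero_coe_root k) ?_ (hS j hj) hi
  rw [add_comm]
  exact congrArg DFunLike.coe hk

theorem mem_of_mem_rootSpace_neg_of_isPos (S : LieSubalgebra K L)
    (hS : ∀ i ∈ b.support, ∀ x ∈ rootSpace H (-(i.1 : H → K)), x ∈ S) {α : H.root}
    (hα : b.IsPos α) : ∀ x ∈ rootSpace H (-(α.1 : H → K)), x ∈ S := by
  refine hα.induction_on_add (p := fun α ↦ ∀ x ∈ rootSpace H (-(α.1 : H → K)), x ∈ S) hS ?_
  intro i j k hk hi hj
  simp only [← Weight.coe_neg] at hS hi ⊢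
  refine mem_of_mem_rootSpace_of_eq_add S (LieSubalgebra.isNonZero_coe_root j).neg
    (LieSubalgebra.isNonZero_coe_root k).neg ?_ (hS j hj) hi
  have hk' : (k.1 : H → K) = i.1 + j.1 := congrArg DFunLike.coe hk
  simp only [Weight.coe_neg, hk', neg_add_rev]

theorem isPos_or_exists_eq_neg (α : H.root) :
    b.IsPos α ∨ ∃ β : H.root, b.IsPos β ∧ (α.1 : H → K) = -β.1 := by
  let := (rootSystem H).indexNeg
  refine (RootPairing.Base.IsPos.or_neg b α).imp_right fun hα ↦ ⟨-α, hα, ?_⟩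
  have hneg : (rootSystem H).root (-α) = -(rootSystem H).root α := by
    rw [RootPairing.indexNeg_neg, RootPairing.root_reflectionPerm,
      RootPairing.reflection_apply_self]
  rw [← neg_eq_iff_eq_neg]
  exact (congrArg DFunLike.coe hneg).symm

theorem lieSubalgebra_eq_top_of_simple_rootSpaces (S : LieSubalgebra K L)
    (hH : ∀ h : H, (h : L) ∈ S)
    (hpos : ∀ i ∈ b.support, ∀ x ∈ rootSpace H (i.1 : H → K), x ∈ S)
    (hneg : ∀ i ∈ b.support, ∀ x ∈ rootSpace H (-(i.1 : H → K)), x ∈ S) : S = ⊤ := by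
  rw [← LieSubalgebra.toSubmodule_inj]
  refine eq_top_of_cartan_le_of_rootSpace_le S.toSubmodule hH fun α ↦ ?_
  rcases isPos_or_exists_eq_neg b α with hα | ⟨β, hβ, hαβ⟩
  · exact mem_of_mem_rootSpace_of_isPos b S hpos hα
  · rw [hαβ]
    exact mem_of_mem_rootSpace_neg_of_isPos b S hneg hβ

end Base

end Generation

/-! ### The form on `H^*` and the cone of positive roots -/

section Cone

open LieAlgebra LieAlgebra.IsKilling LieModule

variable {K L : Type*} [Field K] [LieRing L] [LieAlgebra K L] [FiniteDimensional K L]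
  [IsKilling K L] {H : LieSubalgebra K L} [H.IsCartanSubalgebra]

variable (H) in
/-- The bilinear form on `H^*` that corresponds to the Killing form under the identification of
`H` with `H^*`, written so that linearity in both arguments is manifest: `(σ, τ) = σ (t_τ)`, where
`t_τ ∈ H` represents `τ`. -/
def dualKillingForm : LinearMap.BilinForm K (Module.Dual K H) :=
  (cartanEquivDual H).symm.toLinearMap.dualMap

theorem killingForm_cartanEquivDual_symm (σ : Module.Dual K H) (h : H) :
    killingForm K L ((cartanEquivDual H).symm σ : H) h = σ h :=
  LinearMap.congr_fun ((cartanEquivDual H).apply_symm_apply σ) h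

theorem dualKillingForm_eq_killingForm (σ τ : Module.Dual K H) :
    dualKillingForm H σ τ =
      killingForm K L ((cartanEquivDual H).symm σ : H) ((cartanEquivDual H).symm τ : H) :=
  (killingForm_cartanEquivDual_symm σ _).symm

theorem dualKillingForm_comm (σ τ : Module.Dual K H) :
    dualKillingForm H σ τ = dualKillingForm H τ σ := by
  rw [dualKillingForm_eq_killingForm, dualKillingForm_eq_killingForm, LieModule.traceForm_comm]

variable [CharZero K] [IsTriangularizable K H L]

theorem dualKillingForm_root_self_ne_zero (α : H.root) :
    dualKillingForm H ((rootSystem H).root α) ((rootSystem H).root α) ≠ 0 :=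
  root_apply_cartanEquivDual_symm_ne_zero (LieSubalgebra.isNonZero_coe_root α)

theorem dualKillingForm_root (σ : Module.Dual K H) (α : H.root) :
    dualKillingForm H σ ((rootSystem H).root α) = σ ((rootSystem H).coroot α) *
      (dualKillingForm H ((rootSystem H).root α) ((rootSystem H).root α) / 2) := by
  have hα := dualKillingForm_root_self_ne_zero α
  have hcoroot : (rootSystem H).coroot α =
      (2 * (dualKillingForm H ((rootSystem H).root α) ((rootSystem H).root α))⁻¹) •
        (cartanEquivDual H).symm ((rootSystem H).root α) := by
    rw [mul_smul, ofNat_smul_eq_nsmul]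
    rfl
  rw [hcoroot, map_smul, smul_eq_mul]
  change dualKillingForm H σ ((rootSystem H).root α) =
    _ * dualKillingForm H σ ((rootSystem H).root α) * _
  field_simp

theorem dualKillingForm_root_self_mul_killingForm_coroot_self (α : H.root) :
    dualKillingForm H ((rootSystem H).root α) ((rootSystem H).root α) *
      killingForm K L ((rootSystem H).coroot α : H) ((rootSystem H).coroot α : H) = 4 := by
  have hα := dualKillingForm_root_self_ne_zero α
  have h := traceForm_coroot α.1 ((rootSystem H).coroot α)
  rw [← restrict_killingForm K L H, LinearMap.BilinForm.restrict_apply,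
    show α.1 ((rootSystem H).coroot α) = 2 from
      root_apply_coroot (LieSubalgebra.isNonZero_coe_root α)] at h
  change _ = 2 • (dualKillingForm H ((rootSystem H).root α) ((rootSystem H).root α))⁻¹ • 2 at h
  refine (congrArg _ h).trans ?_
  rw [nsmul_eq_mul, smul_eq_mul]
  field_simp
  norm_num

theorem exists_pos_rat_dualKillingForm_root_self (α : H.root) :
    ∃ r : ℚ, 0 < r ∧
      dualKillingForm H ((rootSystem H).root α) ((rootSystem H).root α) = r := by
  obtain ⟨s, hs, hs'⟩ := ((rootSystem H).flip.posRootForm ℤ).exists_pos_eq α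
  have hform : (rootSystem H).flip.RootForm ((rootSystem H).coroot α) ((rootSystem H).coroot α) =
      killingForm K L ((rootSystem H).coroot α : H) ((rootSystem H).coroot α : H) :=
    LinearMap.congr_fun₂ (corootForm_rootSystem_eq_killing (K := K) (L := L) (H := H)) _ _
  have hmul := dualKillingForm_root_self_mul_killingForm_coroot_self α
  rw [← hform, show (rootSystem H).flip.RootForm ((rootSystem H).coroot α)
    ((rootSystem H).coroot α) = s from hs'.symm] at hmul
  have hsK : (s : K) ≠ 0 := by exact_mod_cast hs.ne'
  refine ⟨4 / s, by have : (0 : ℚ) < s := by exact_mod_cast hs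
                    positivity, ?_⟩
  rw [eq_div_of_mul_eq hsK hmul]
  push_cast
  rfl

variable (b : (rootSystem H).Base)

/-- The cone `Q⁺` of sums of simple roots. -/
def posCone : AddSubmonoid (Module.Dual K H) :=
  AddSubmonoid.closure ((rootSystem H).root '' b.support)

/-- Dominant integral weights, as a predicate on `H^*`. -/
def IsDominantIntegral (σ : Module.Dual K H) : Prop :=
  ∀ i ∈ b.support, ∃ n : ℕ, σ ((rootSystem H).coroot i) = n

variable {b}

theorem root_mem_posCone {i : H.root} (hi : i ∈ b.support) :
    (rootSystem H).root i ∈ posCone b :=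
  AddSubmonoid.subset_closure ⟨i, hi, rfl⟩

theorem exists_nonneg_rat_of_mem_posCone {φ : Module.Dual K (Module.Dual K H)}
    (hφ : ∀ i ∈ b.support, ∃ r : ℚ, 0 ≤ r ∧ φ ((rootSystem H).root i) = r)
    {p : Module.Dual K H} (hp : p ∈ posCone b) : ∃ r : ℚ, 0 ≤ r ∧ φ p = r := by
  induction hp using AddSubmonoid.closure_induction with
  | mem p hp =>
    obtain ⟨i, hi, rfl⟩ := hp
    exact hφ i hi
  | zero => exact ⟨0, le_rfl, by simp⟩
  | add p q _ _ hp hq =>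
    obtain ⟨r, hr, hr'⟩ := hp
    obtain ⟨s, hs, hs'⟩ := hq
    exact ⟨r + s, add_nonneg hr hs, by rw [map_add, hr', hs', Rat.cast_add]⟩

theorem exists_pos_rat_of_mem_posCone {φ : Module.Dual K (Module.Dual K H)}
    (hφ : ∀ i ∈ b.support, ∃ r : ℚ, 0 < r ∧ φ ((rootSystem H).root i) = r)
    {p : Module.Dual K H} (hp : p ∈ posCone b) (hp0 : p ≠ 0) : ∃ r : ℚ, 0 < r ∧ φ p = r := by
  revert hp0
  induction hp using AddSubmonoid.closure_induction with
  | mem p hp =>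
    obtain ⟨i, hi, rfl⟩ := hp
    exact fun _ ↦ hφ i hi
  | zero => exact fun h ↦ absurd rfl h
  | add p q _ _ hp hq =>
    intro hpq
    by_cases hp0 : p = 0
    · rw [hp0, zero_add] at hpq ⊢
      exact hq hpq
    by_cases hq0 : q = 0
    · rw [hq0, add_zero] at hpq ⊢
      exact hp hpq
    obtain ⟨r, hr, hr'⟩ := hp hp0
    obtain ⟨s, hs, hs'⟩ := hq hq0
    exact ⟨r + s, add_pos hr hs, by rw [map_add, hr', hs', Rat.cast_add]⟩

variable (b) in
/-- The height function on `H^*`: the linear form that is one on every simple root. -/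
def height : Module.Dual K (Module.Dual K H) :=
  b.toWeightBasis.constr K fun _ ↦ (1 : K)

theorem height_root {i : H.root} (hi : i ∈ b.support) : height b ((rootSystem H).root i) = 1 := by
  have h := b.toWeightBasis.constr_basis K (fun _ ↦ (1 : K)) ⟨i, hi⟩
  rwa [RootPairing.Base.toWeightBasis_apply] at h

theorem eq_zero_of_add_eq_zero_of_mem_posCone {p q : Module.Dual K H} (hp : p ∈ posCone b)
    (hq : q ∈ posCone b) (h : p + q = 0) : p = 0 := by
  by_contra hp0
  have hheight : ∀ i ∈ b.support, ∃ r : ℚ, 0 < r ∧ height b ((rootSystem H).root i) = r :=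
    fun i hi ↦ ⟨1, one_pos, by rw [height_root hi, Rat.cast_one]⟩
  obtain ⟨r, hr, hpr⟩ := exists_pos_rat_of_mem_posCone hheight hp hp0
  obtain ⟨s, hs, hqs⟩ := exists_nonneg_rat_of_mem_posCone
    (fun i hi ↦ (hheight i hi).imp fun _ ↦ And.imp_left le_of_lt) hq
  have hsum : ((r + s : ℚ) : K) = 0 := by
    rw [Rat.cast_add, ← hpr, ← hqs, ← map_add, h, map_zero]
  exact (add_pos_of_pos_of_nonneg hr hs).ne' (by exact_mod_cast hsum)

theorem IsDominantIntegral.exists_nonneg_rat_dualKillingForm {σ : Module.Dual K H}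
    (hσ : IsDominantIntegral b σ) {p : Module.Dual K H} (hp : p ∈ posCone b) :
    ∃ r : ℚ, 0 ≤ r ∧ dualKillingForm H σ p = r := by
  refine exists_nonneg_rat_of_mem_posCone (fun i hi ↦ ?_) hp
  obtain ⟨n, hn⟩ := hσ i hi
  obtain ⟨r, hr, hr'⟩ := exists_pos_rat_dualKillingForm_root_self i
  refine ⟨n * (r / 2), by positivity, ?_⟩
  rw [dualKillingForm_root, hn, hr']
  push_cast
  rfl

theorem dualKillingForm_ne_zero_of_coroot_pos {σ : Module.Dual K H}
    (hσ : ∀ i ∈ b.support, ∃ n : ℕ, 0 < n ∧ σ ((rootSystem H).coroot i) = n)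
    {p : Module.Dual K H} (hp : p ∈ posCone b) (hp0 : p ≠ 0) : dualKillingForm H σ p ≠ 0 := by
  obtain ⟨r, hr, hr'⟩ : ∃ r : ℚ, 0 < r ∧ dualKillingForm H σ p = r := by
    refine exists_pos_rat_of_mem_posCone (fun i hi ↦ ?_) hp hp0
    obtain ⟨n, hn0, hn⟩ := hσ i hi
    obtain ⟨r, hr, hr'⟩ := exists_pos_rat_dualKillingForm_root_self i
    refine ⟨n * (r / 2), by positivity, ?_⟩
    rw [dualKillingForm_root, hn, hr']
    push_cast
    rfl
  rw [hr']
  exact_mod_cast hr.ne'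

open Classical in
variable (b) in
/-- The sum `2ρ` of the positive roots. -/
def twoRho : Module.Dual K H := ∑ α : H.root with b.IsPos α, (rootSystem H).root α

/- The simple reflection `s_i` permutes the positive roots other than `α_i`, and it changes the sign
of the pairing with the `i`-th coroot. -/
theorem twoRho_coroot {i : H.root} (hi : i ∈ b.support) :
    twoRho b ((rootSystem H).coroot i) = 2 := by
  classical
  have hi_pos := b.isPos_of_mem_support hi
  set σ := (rootSystem H).reflectionPerm i
  set S := (Finset.univ.filter fun α : H.root ↦ b.IsPos α).erase i with hS
  have hσσ : ∀ α, σ (σ α) = α := fun α ↦ by simp [σ]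
  have hσS : ∀ α ∈ S, σ α ∈ S := by
    intro α hα
    simp only [hS, Finset.mem_erase, Finset.mem_filter, Finset.mem_univ, true_and] at hα ⊢
    refine ⟨fun h ↦ ?_, hα.2.reflectionPerm hi hα.1⟩
    let := (rootSystem H).indexNeg
    have hneg : α = -i := by
      rw [← hσσ α, h]
      rfl
    exact (RootPairing.Base.IsPos.neg_iff_not b i).mp (hneg ▸ hα.2) hi_pos
  have hσ_neg : ∀ α, (rootSystem H).root (σ α) ((rootSystem H).coroot i) =
      -(rootSystem H).root α ((rootSystem H).coroot i) := by
    intro α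
    have h := (rootSystem H).pairing_reflectionPerm i α i
    rw [RootPairing.pairing_reflectionPerm_self_right] at h
    exact h.symm
  have hsum : ∑ α ∈ S, (rootSystem H).root α ((rootSystem H).coroot i) = 0 := by
    refine self_eq_neg.mp ?_
    rw [← Finset.sum_neg_distrib]
    simp only [← hσ_neg]
    exact Finset.sum_nbij' σ σ hσS hσS (fun α _ ↦ hσσ α) (fun α _ ↦ hσσ α) fun α _ ↦ by rw [hσσ]
  rw [twoRho, LinearMap.sum_apply, ← Finset.add_sum_erase _ _ (a := i) (by simpa using hi_pos),
    hsum, add_zero]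
  exact root_apply_coroot (LieSubalgebra.isNonZero_coe_root i)

variable (b) in
/-- The number `(ν, ν + 2ρ)`, by which the Casimir operator acts on a singular vector of
weight `ν`. -/
def casimirValue (ν : Module.Dual K H) : K := dualKillingForm H ν (ν + twoRho b)

/- The two values differ by `(2ν + p + 2ρ, p)`, which is positive unless `p = 0`. -/
theorem eq_zero_of_casimirValue_add_eq {ν p : Module.Dual K H} (hp : p ∈ posCone b)
    (hν : IsDominantIntegral b ν) (hνp : IsDominantIntegral b (ν + p))
    (h : casimirValue b (ν + p) = casimirValue b ν) : p = 0 := by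
  by_contra hp0
  refine dualKillingForm_ne_zero_of_coroot_pos (σ := (ν + p) + ν + twoRho b) (fun i hi ↦ ?_)
    hp hp0 ?_
  · obtain ⟨m, hm⟩ := hν i hi
    obtain ⟨n, hn⟩ := hνp i hi
    refine ⟨n + m + 2, by omega, ?_⟩
    rw [LinearMap.add_apply, LinearMap.add_apply, hm, hn, twoRho_coroot hi]
    push_cast
    rfl
  · have h1 := dualKillingForm_comm ν p
    have h2 := dualKillingForm_comm (twoRho b) p
    simp only [casimirValue, map_add, LinearMap.add_apply] at h ⊢
    linear_combination h + h1 + h2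

end Cone

/-! ### Weight vectors and singular vectors -/

section WeightVectors

open LieAlgebra LieAlgebra.IsKilling LieModule

variable {K L M N : Type*} [Field K] [LieRing L] [LieAlgebra K L] {H : LieSubalgebra K L}
  [AddCommGroup M] [Module K M] [LieRingModule L M]
  [AddCommGroup N] [Module K N] [LieRingModule L N]

/-- Weight vectors of weight `k`; the zero vector is allowed. -/
def IsWeightVec (k : Module.Dual K H) (m : M) : Prop := ∀ h : H, ⁅(h : L), m⁆ = k h • m

theorem IsWeightVec.eq_of_ne_zero {k l : Module.Dual K H} {m : M} (hk : IsWeightVec k m)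
    (hl : IsWeightVec l m) (hm : m ≠ 0) : k = l :=
  LinearMap.ext fun h ↦ smul_left_injective K hm ((hk h).symm.trans (hl h))

theorem IsWeightVec.map {k : Module.Dual K H} {m : M} (hm : IsWeightVec k m)
    (f : M →ₗ⁅K,L⁆ N) : IsWeightVec k (f m) := fun h ↦ by
  rw [← f.map_lie, hm h, map_smul]

section

variable [LieModule K L M]

variable (M) in
/-- The space of weight vectors of weight `k`, as a subspace of the `L`-module `M`. -/
def weightSubmodule (k : Module.Dual K H) : Submodule K M where
  carrier := {m | IsWeightVec k m}
  add_mem' hm hn h := by rw [lie_add, hm h, hn h, smul_add]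
  zero_mem' h := by rw [lie_zero, smul_zero]
  smul_mem' c m hm h := by rw [lie_smul, hm h, smul_comm]

theorem iSupIndep_weightSubmodule [LieRing.IsNilpotent H] :
    iSupIndep fun k : Module.Dual K H ↦ weightSubmodule M k := by
  have h := (iSupIndep_genWeightSpace K H M).comp
    (f := fun k : Module.Dual K H ↦ (k : H → K)) DFunLike.coe_injective
  rw [← LieSubmodule.iSupIndep_toSubmodule] at h
  exact h.mono fun k m hm ↦
    weightSpace_le_genWeightSpace M (k : H → K) ((mem_weightSpace (k : H → K) m).mpr hm)

theorem IsWeightVec.eq_zero_of_mem_iSup [LieRing.IsNilpotent H] {k : Module.Dual K H} {m : M}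
    (hm : IsWeightVec k m) {T : Set (Module.Dual K H)} (hT : k ∉ T)
    (h : m ∈ ⨆ l ∈ T, weightSubmodule M l) : m = 0 := by
  have hle : ⨆ l ∈ T, weightSubmodule M l ≤ ⨆ (l) (_ : l ≠ k), weightSubmodule M l :=
    iSup₂_le fun l hl ↦ le_iSup₂_of_le l (ne_of_mem_of_not_mem hl hT) le_rfl
  exact Submodule.disjoint_def.mp ((iSupIndep_weightSubmodule k).mono_right hle) m hm h

/-- The vectors of a Lie algebra that kill `m`, as a Lie subalgebra. -/
def annihilatorOf (K L : Type*) {M : Type*} [Field K] [LieRing L] [LieAlgebra K L]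
    [AddCommGroup M] [Module K M] [LieRingModule L M] [LieModule K L M] (m : M) :
    LieSubalgebra K L where
  __ := LinearMap.ker ((toEnd K L M : L →ₗ[K] Module.End K M).flip m)
  lie_mem' {x y} hx hy := by
    have hx' : ⁅x, m⁆ = 0 := hx
    have hy' : ⁅y, m⁆ = 0 := hy
    change ⁅⁅x, y⁆, m⁆ = 0
    rw [lie_lie, hx', hy', lie_zero, lie_zero, sub_zero]

end

variable [FiniteDimensional K L] [H.IsCartanSubalgebra] [IsTriangularizable K H L] [CharZero K]
  [IsKilling K L]

/-- Singular vectors of weight `k`: weight vectors killed by the simple root vectors. -/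
structure IsSingular (b : (rootSystem H).Base) (k : Module.Dual K H) (m : M) : Prop where
  isWeightVec : IsWeightVec k m
  lie_eq_zero : ∀ i ∈ b.support, ∀ x ∈ rootSpace H (i.1 : H → K), ⁅x, m⁆ = 0

variable {b : (rootSystem H).Base}

theorem IsSingular.map {k : Module.Dual K H} {m : M} (hm : IsSingular b k m)
    (f : M →ₗ⁅K,L⁆ N) : IsSingular b k (f m) :=
  ⟨hm.isWeightVec.map f, fun i hi x hx ↦ by rw [← f.map_lie, hm.lie_eq_zero i hi x hx, map_zero]⟩

variable [LieModule K L M]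

theorem IsWeightVec.lie {k γ : Module.Dual K H} {m : M} (hm : IsWeightVec k m) {x : L}
    (hx : x ∈ rootSpace H (γ : H → K)) : IsWeightVec (k + γ) ⁅x, m⁆ := by
  intro h
  have hγ : ⁅(h : L), x⁆ = γ h • x := lie_eq_smul_of_mem_rootSpace hx h
  rw [leibniz_lie, hγ, hm h, smul_lie, lie_smul, ← add_smul, add_comm, LinearMap.add_apply]

theorem IsSingular.lie_eq_zero_of_isPos {k : Module.Dual K H} {m : M} (hm : IsSingular b k m)
    {α : H.root} (hα : b.IsPos α) {x : L} (hx : x ∈ rootSpace H (α.1 : H → K)) : ⁅x, m⁆ = 0 :=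
  mem_of_mem_rootSpace_of_isPos b (annihilatorOf K L m) hm.lie_eq_zero hα x hx

end WeightVectors

/-! ### The Casimir operator -/

section Casimir

open LieAlgebra LieAlgebra.IsKilling LieModule

variable {K L J : Type*} [Field K] [LieRing L] [LieAlgebra K L] [Fintype J] {e f : J → L}

/-- The families `e` and `f` in `L` are dual to each other with respect to the Killing form: the
coefficients of a vector with respect to `e` are its pairings with `f`. -/
def IsKillingDual (K : Type*) {L J : Type*} [Field K] [LieRing L] [LieAlgebra K L] [Fintype J]
    (e f : J → L) : Prop := ∀ z, ∑ j, killingForm K L (f j) z • e j = z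

theorem IsKillingDual.swap [FiniteDimensional K L] [IsKilling K L] (h : IsKillingDual K e f) :
    IsKillingDual K f e := by
  intro z
  refine sub_eq_zero.mp ((Submodule.mem_bot K).mp ?_)
  rw [← ker_killingForm_eq_bot K L, LinearMap.mem_ker]
  ext w
  have hw := congrArg (fun y ↦ killingForm K L y z) (h w)
  simp only [map_sum, map_smul, LinearMap.sum_apply, LinearMap.smul_apply, smul_eq_mul] at hw
  simp only [map_sub, map_sum, map_smul, LinearMap.sub_apply, LinearMap.sum_apply,
    LinearMap.smul_apply, smul_eq_mul, LinearMap.zero_apply, sub_eq_zero]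
  rw [traceForm_comm K L L z w, ← hw]
  exact Finset.sum_congr rfl fun _ _ ↦ mul_comm _ _

variable {M : Type*} [AddCommGroup M] [Module K M] [LieRingModule L M] [LieModule K L M]

/-- The operator `∑ j, e j * f j` on an `L`-module: the Casimir operator if `e` and `f` are dual to
each other with respect to the Killing form. -/
def casimir (K : Type*) {L J : Type*} (M : Type*) [Field K] [LieRing L] [LieAlgebra K L]
    [AddCommGroup M] [Module K M] [LieRingModule L M] [LieModule K L M] [Fintype J] (e f : J → L) :
    Module.End K M :=
  ∑ j, toEnd K L M (e j) ∘ₗ toEnd K L M (f j)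

theorem casimir_apply (m : M) : casimir K M e f m = ∑ j, ⁅e j, ⁅f j, m⁆⁆ := by
  simp only [casimir, LinearMap.sum_apply, LinearMap.comp_apply, toEnd_apply_apply]

theorem IsKillingDual.lie_casimir [FiniteDimensional K L] [IsKilling K L]
    (h : IsKillingDual K e f) (x : L) (m : M) :
    ⁅x, casimir K M e f m⁆ = casimir K M e f ⁅x, m⁆ := by
  have he : ∀ j, ⁅⁅x, e j⁆, ⁅f j, m⁆⁆ =
      ∑ k, killingForm K L (f k) ⁅x, e j⁆ • ⁅e k, ⁅f j, m⁆⁆ := by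
    intro j
    conv_lhs => rw [← h ⁅x, e j⁆]
    simp only [sum_lie, smul_lie]
  have hf : ∀ k, ⁅e k, ⁅⁅x, f k⁆, m⁆⁆ =
      ∑ j, killingForm K L (e j) ⁅x, f k⁆ • ⁅e k, ⁅f j, m⁆⁆ := by
    intro k
    conv_lhs => rw [← h.swap ⁅x, f k⁆]
    simp only [sum_lie, smul_lie, lie_sum, lie_smul]
  have hinv : ∀ j k, killingForm K L (e j) ⁅x, f k⁆ = -killingForm K L (f k) ⁅x, e j⁆ := by
    intro j k
    rw [killingForm, ← traceForm_apply_lie_apply K L L (e j) x (f k), traceForm_comm, ← lie_skew,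
      map_neg]
  have hcancel : ∑ j, ⁅⁅x, e j⁆, ⁅f j, m⁆⁆ + ∑ k, ⁅e k, ⁅⁅x, f k⁆, m⁆⁆ = 0 := by
    simp only [he, hf, hinv, neg_smul, Finset.sum_neg_distrib]
    rw [Finset.sum_comm, add_neg_cancel]
  rw [casimir_apply, casimir_apply, lie_sum]
  simp only [leibniz_lie x (e _), leibniz_lie x (f _), lie_add, Finset.sum_add_distrib]
  rw [← add_assoc, hcancel, zero_add]

variable [FiniteDimensional K L] {H : LieSubalgebra K L} [H.IsCartanSubalgebra]

theorem coe_mem_rootSpace_zero (h : H) : (h : L) ∈ rootSpace H (0 : H → K) := by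
  rw [← LieSubmodule.mem_toSubmodule, rootSpace_zero_eq]
  exact h.2

variable (H) in
/-- A choice of root vectors `e α` and `f α`, for the roots `α` and `-α`, that pair to one under
the Killing form. -/
structure DualRootVectors where
  e : H.root → L
  f : H.root → L
  e_mem : ∀ α, e α ∈ rootSpace H (α.1 : H → K)
  f_mem : ∀ α, f α ∈ rootSpace H (-(α.1 : H → K))
  killingForm_f_e : ∀ α, killingForm K L (f α) (e α) = 1

variable [IsKilling K L]

theorem sum_lie_lie_of_isWeightVec {ι : Type*} [Fintype ι] (B : Module.Basis ι K H)
    {ν : Module.Dual K H} {w : M} (hw : IsWeightVec ν w) :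
    ∑ j, ⁅(B j : L), ⁅((cartanEquivDual H).symm (B.coord j) : L), w⁆⁆ =
      dualKillingForm H ν ν • w := by
  have hj (j) : ⁅(B j : L), ⁅((cartanEquivDual H).symm (B.coord j) : L), w⁆⁆ =
      (B.repr ((cartanEquivDual H).symm ν) j * ν (B j)) • w := by
    rw [hw, lie_smul, hw, smul_smul,
      show ν ((cartanEquivDual H).symm (B.coord j)) = _ from dualKillingForm_comm ν (B.coord j)]
    rfl
  simp only [hj]
  rw [← Finset.sum_smul]
  change _ = ν ((cartanEquivDual H).symm ν) • w
  conv_rhs => rw [← B.sum_repr ((cartanEquivDual H).symm ν)]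
  simp only [map_sum, map_smul, smul_eq_mul]

variable [IsTriangularizable K H L]

instance [CharZero K] : Nonempty (DualRootVectors H) := by
  have hex (α : H.root) : ∃ e ∈ rootSpace H (α.1 : H → K),
      ∃ f ∈ rootSpace H (-(α.1 : H → K)), killingForm K L f e = 1 := by
    obtain ⟨e, he, he0⟩ := α.1.exists_ne_zero
    obtain ⟨f, hf, hef⟩ : ∃ f ∈ rootSpace H (-(α.1 : H → K)), killingForm K L e f ≠ 0 := by
      contrapose! he0
      simpa using mem_ker_killingForm_of_mem_rootSpace_of_forall_rootSpace_neg K L H he he0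
    refine ⟨e, he, (killingForm K L e f)⁻¹ • f, Submodule.smul_mem _ _ hf, ?_⟩
    rw [traceForm_comm, map_smul, smul_eq_mul, inv_mul_cancel₀ hef]
  choose e he f hf hfe using hex
  exact ⟨⟨e, f, he, hf, hfe⟩⟩

namespace DualRootVectors

variable (d : DualRootVectors H)

/-- A basis of `H` together with the root vectors `d.e`. -/
def vec : Fin (Module.finrank K H) ⊕ H.root → L :=
  Sum.elim (fun j ↦ (Module.finBasis K H j : L)) d.e

/-- The family dual to `d.vec`: the Killing duals of the coordinates on `H` and the root vectors
`d.f`. -/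
def dualVec : Fin (Module.finrank K H) ⊕ H.root → L :=
  Sum.elim (fun j ↦ ((cartanEquivDual H).symm ((Module.finBasis K H).coord j) : L)) d.f

theorem sum_killingForm_dualVec_smul_vec_cartan (h : H) :
    ∑ j, killingForm K L (d.dualVec j) h • d.vec j = h := by
  have hf (α : H.root) : killingForm K L (d.f α) h = 0 :=
    killingForm_apply_eq_zero_of_mem_rootSpace_of_add_ne_zero K L H (d.f_mem α)
      (coe_mem_rootSpace_zero h) (by simp)
  simp only [Fintype.sum_sum_type, dualVec, vec, Sum.elim_inl, Sum.elim_inr, hf, zero_smul,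
    Finset.sum_const_zero, add_zero, killingForm_cartanEquivDual_symm]
  have hrepr := congrArg H.toSubmodule.subtype ((Module.finBasis K H).sum_repr h)
  rwa [map_sum] at hrepr

variable [CharZero K]

theorem sum_killingForm_dualVec_smul_vec_rootSpace {α : H.root} {x : L}
    (hx : x ∈ rootSpace H (α.1 : H → K)) :
    ∑ j, killingForm K L (d.dualVec j) x • d.vec j = x := by
  have hh (h : H) : killingForm K L h x = 0 :=
    killingForm_apply_eq_zero_of_mem_rootSpace_of_add_ne_zero K L H (coe_mem_rootSpace_zero h) hx
      (by simp)
  have hf (β : H.root) (hβ : β ≠ α) : killingForm K L (d.f β) x = 0 :=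
    killingForm_apply_eq_zero_of_mem_rootSpace_of_add_ne_zero K L H (d.f_mem β) hx fun h ↦
      hβ (Subtype.ext (DFunLike.coe_injective (neg_add_eq_zero.mp h)))
  simp only [Fintype.sum_sum_type, dualVec, vec, Sum.elim_inl, Sum.elim_inr, hh, zero_smul,
    Finset.sum_const_zero, zero_add]
  rw [Finset.sum_eq_single α (fun β _ hβ ↦ by rw [hf β hβ, zero_smul]) (by simp)]
  have he : (⟨d.e α, d.e_mem α⟩ : rootSpace H (α.1 : H → K)) ≠ 0 := by
    intro h
    have h1 := d.killingForm_f_e α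
    rw [show d.e α = 0 from congrArg Subtype.val h, map_zero] at h1
    exact zero_ne_one h1
  obtain ⟨c, hc⟩ := (finrank_eq_one_iff_of_nonzero' _ he).mp
    (finrank_rootSpace_eq_one _ (LieSubalgebra.isNonZero_coe_root α)) ⟨x, hx⟩
  have hc' : c • d.e α = x := congrArg Subtype.val hc
  rw [← hc', map_smul, d.killingForm_f_e, smul_eq_mul, mul_one]

theorem isKillingDual : IsKillingDual K d.vec d.dualVec := by
  let S := LinearMap.eqLocus
    (∑ j, (killingForm K L (d.dualVec j)).smulRight (d.vec j)) LinearMap.id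
  have hS (z : L) : z ∈ S ↔ ∑ j, killingForm K L (d.dualVec j) z • d.vec j = z := by
    simp [S, LinearMap.mem_eqLocus, LinearMap.sum_apply]
  have htop : S = ⊤ := eq_top_of_cartan_le_of_rootSpace_le (H := H) S
    (fun h ↦ (hS h).mpr (d.sum_killingForm_dualVec_smul_vec_cartan h))
    fun α x hx ↦ (hS x).mpr (d.sum_killingForm_dualVec_smul_vec_rootSpace hx)
  exact fun z ↦ (hS z).mp (htop ▸ Submodule.mem_top)

variable {b : (rootSystem H).Base} {ν : Module.Dual K H} {w : M}

theorem lie_e_lie_f_of_isPos (hw : IsSingular b ν w) {α : H.root} (hα : b.IsPos α) :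
    ⁅d.e α, ⁅d.f α, w⁆⁆ = dualKillingForm H ν ((rootSystem H).root α) • w := by
  have hef := lie_eq_killingForm_smul_of_mem_rootSpace_of_mem_rootSpace_neg (d.e_mem α) (d.f_mem α)
  rw [traceForm_comm, d.killingForm_f_e, one_smul] at hef
  rw [leibniz_lie, hw.lie_eq_zero_of_isPos hα (d.e_mem α), lie_zero, add_zero, hef]
  exact hw.isWeightVec _

theorem lie_f_of_not_isPos (hw : IsSingular b ν w) {α : H.root} (hα : ¬ b.IsPos α) :
    ⁅d.f α, w⁆ = 0 := by
  obtain ⟨β, hβ, h⟩ := (isPos_or_exists_eq_neg b α).resolve_left hα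
  have hf := d.f_mem α
  rw [h, neg_neg] at hf
  exact hw.lie_eq_zero_of_isPos hβ hf

theorem casimir_of_isSingular (hw : IsSingular b ν w) :
    casimir K M d.vec d.dualVec w = casimirValue b ν • w := by
  classical
  rw [casimir_apply, Fintype.sum_sum_type, casimirValue, map_add, add_smul]
  refine congrArg₂ (· + ·) (sum_lie_lie_of_isWeightVec _ hw.isWeightVec) ?_
  rw [twoRho, map_sum, Finset.sum_smul, Finset.sum_filter]
  refine Finset.sum_congr rfl fun α _ ↦ ?_
  change ⁅d.e α, ⁅d.f α, w⁆⁆ = _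
  split_ifs with hα
  · exact d.lie_e_lie_f_of_isPos hw hα
  · rw [d.lie_f_of_not_isPos hw hα, lie_zero]

end DualRootVectors

end Casimir

/-! ### Generation by negative root vectors -/

section NegSpan

open LieAlgebra LieAlgebra.IsKilling LieModule

variable {K L M N : Type*} [Field K] [LieRing L] [LieAlgebra K L] {H : LieSubalgebra K L}
  [AddCommGroup M] [Module K M] [LieRingModule L M]
  [AddCommGroup N] [Module K N] [LieRingModule L N]

variable (L) in
/-- The elements of a Lie algebra that map the subspace `S` into itself, as a Lie subalgebra. -/
def stabilizerOf [LieModule K L M] (S : Submodule K M) : LieSubalgebra K L where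
  carrier := {x | ∀ m ∈ S, ⁅x, m⁆ ∈ S}
  add_mem' hx hy m hm := by
    rw [add_lie]
    exact add_mem (hx m hm) (hy m hm)
  zero_mem' m _ := by
    rw [zero_lie]
    exact zero_mem S
  smul_mem' c x hx m hm := by
    rw [smul_lie]
    exact S.smul_mem c (hx m hm)
  lie_mem' {x y} hx hy m hm := by
    rw [lie_lie]
    exact sub_mem (hx _ (hy m hm)) (hy _ (hx m hm))

variable [FiniteDimensional K L] [H.IsCartanSubalgebra] [IsTriangularizable K H L] [CharZero K]
  [IsKilling K L]

/-- Subspaces that are stable under the root vectors for the negatives of the simple roots. -/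
def IsNegStable (b : (rootSystem H).Base) (S : Submodule K M) : Prop :=
  ∀ i ∈ b.support, ∀ y ∈ rootSpace H (-(i.1 : H → K)), ∀ m ∈ S, ⁅y, m⁆ ∈ S

/-- The smallest subspace that contains `A` and is stable under the root vectors for the negatives
of the simple roots, that is `U(𝔫⁻) A`. -/
def negSpan (b : (rootSystem H).Base) (A : Set M) : Submodule K M :=
  sInf {S | A ⊆ S ∧ IsNegStable b S}

variable {b : (rootSystem H).Base} {A : Set M}

theorem subset_negSpan : A ⊆ negSpan b A := fun _ ha ↦
  Submodule.mem_sInf.mpr fun _ hS ↦ hS.1 ha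

theorem isNegStable_negSpan : IsNegStable b (negSpan b A) := fun i hi y hy m hm ↦
  Submodule.mem_sInf.mpr fun S hS ↦ hS.2 i hi y hy m (Submodule.mem_sInf.mp hm S hS)

theorem negSpan_le {S : Submodule K M} (hA : A ⊆ S) (hS : IsNegStable b S) : negSpan b A ≤ S :=
  sInf_le ⟨hA, hS⟩

theorem map_negSpan (f : M →ₗ⁅K,L⁆ N) :
    (negSpan b A).map (f : M →ₗ[K] N) = negSpan b (f '' A) := by
  refine le_antisymm (Submodule.map_le_iff_le_comap.mpr ?_) (negSpan_le ?_ ?_)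
  · refine negSpan_le (fun a ha ↦ subset_negSpan ⟨a, ha, rfl⟩) fun i hi y hy m hm ↦ ?_
    change f ⁅y, m⁆ ∈ negSpan b (f '' A)
    rw [f.map_lie]
    exact isNegStable_negSpan i hi y hy _ hm
  · exact Set.image_mono subset_negSpan
  · rintro i hi y hy _ ⟨m, hm, rfl⟩
    exact ⟨⁅y, m⁆, isNegStable_negSpan i hi y hy m hm, f.map_lie y m⟩

theorem negSpan_preimage_eq_top {f : M →ₗ⁅K,L⁆ N} (hf : Function.Injective f) {A : Set N}
    (hA : A ⊆ Set.range f) (hfA : ∀ m, f m ∈ negSpan b A) : negSpan b (f ⁻¹' A) = ⊤ := by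
  rw [eq_top_iff, ← Submodule.map_le_map_iff_of_injective (f := (f : M →ₗ[K] N)) hf, map_negSpan,
    Set.image_preimage_eq_of_subset hA, Submodule.map_le_iff_le_comap]
  exact fun m _ ↦ hfA m

theorem lie_eq_zero_of_simple_of_neg_simple {i j : H.root} (hi : i ∈ b.support)
    (hj : j ∈ b.support) (hij : i ≠ j) {x y : L} (hx : x ∈ rootSpace H (i.1 : H → K))
    (hy : y ∈ rootSpace H (-(j.1 : H → K))) : ⁅x, y⁆ = 0 := by
  have hxy : ⁅x, y⁆ ∈ rootSpace H ((i.1 : H → K) + -(j.1 : H → K)) :=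
    lie_mem_genWeightSpace_of_mem_genWeightSpace hx hy
  by_contra h0
  let χ : Weight K H L := ⟨(i.1 : H → K) + -(j.1 : H → K), fun hbot ↦
    h0 ((LieSubmodule.mem_bot _).mp ((congrArg (⁅x, y⁆ ∈ ·) hbot).mp hxy))⟩
  have hχ : χ.IsNonZero := fun hz ↦ hij (Subtype.ext (DFunLike.coe_injective
    (sub_eq_zero.mp ((sub_eq_add_neg _ _).trans hz))))
  refine b.sub_notMem_range_root hi hj ⟨⟨χ, by simpa using hχ⟩, LinearMap.ext fun h ↦ ?_⟩
  exact (sub_eq_add_neg (i.1 h) (j.1 h)).symm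

variable [LieModule K L M]

theorem IsWeightVec.lie_neg {k γ : Module.Dual K H} {m : M} (hm : IsWeightVec k m) {x : L}
    (hx : x ∈ rootSpace H (-(γ : H → K))) : IsWeightVec (k - γ) ⁅x, m⁆ :=
  sub_eq_add_neg k γ ▸ hm.lie hx

theorem lie_mem_negSpan {x : L} (hA : ∀ a ∈ A, ⁅x, a⁆ ∈ negSpan b A)
    (hx : ∀ i ∈ b.support, ∀ y ∈ rootSpace H (-(i.1 : H → K)), ∀ m ∈ negSpan b A,
      ⁅⁅x, y⁆, m⁆ ∈ negSpan b A) :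
    ∀ m ∈ negSpan b A, ⁅x, m⁆ ∈ negSpan b A := by
  have hle : negSpan b A ≤ negSpan b A ⊓ (negSpan b A).comap (toEnd K L M x) := by
    refine negSpan_le (fun a ha ↦ ⟨subset_negSpan ha, hA a ha⟩) fun i hi y hy m hm ↦
      ⟨isNegStable_negSpan i hi y hy m hm.1, ?_⟩
    change ⁅x, ⁅y, m⁆⁆ ∈ negSpan b A
    rw [leibniz_lie]
    exact add_mem (hx i hi y hy m hm.1) (isNegStable_negSpan i hi y hy _ hm.2)
  exact fun m hm ↦ (hle hm).2

theorem negSpan_eq_lieSpan (hA : ∀ a ∈ A, ∃ k, IsSingular b k a) :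
    negSpan b A = (LieSubmodule.lieSpan K L A).toSubmodule := by
  refine le_antisymm (negSpan_le LieSubmodule.subset_lieSpan fun i _ y _ m hm ↦
    LieSubmodule.lie_mem _ hm) ?_
  have hH (h : H) : ∀ m ∈ negSpan b A, ⁅(h : L), m⁆ ∈ negSpan b A := by
    refine lie_mem_negSpan (fun a ha ↦ ?_) fun i hi y hy m hm ↦ ?_
    · obtain ⟨k, hk⟩ := hA a ha
      rw [hk.isWeightVec h]
      exact Submodule.smul_mem _ _ (subset_negSpan ha)
    · have hhy : ⁅(h : L), y⁆ = (-(i.1 : H → K)) h • y := lie_eq_smul_of_mem_rootSpace hy h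
      rw [hhy, smul_lie]
      exact Submodule.smul_mem _ _ (isNegStable_negSpan i hi y hy m hm)
  have hpos (i) (hi : i ∈ b.support) (x) (hx : x ∈ rootSpace H (i.1 : H → K)) :
      ∀ m ∈ negSpan b A, ⁅x, m⁆ ∈ negSpan b A := by
    refine lie_mem_negSpan (fun a ha ↦ ?_) fun j hj y hy m hm ↦ ?_
    · obtain ⟨k, hk⟩ := hA a ha
      rw [hk.lie_eq_zero i hi x hx]
      exact zero_mem _
    · obtain rfl | hij := eq_or_ne i j
      · rw [lie_eq_killingForm_smul_of_mem_rootSpace_of_mem_rootSpace_neg hx hy, smul_lie]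
        exact Submodule.smul_mem _ _ (hH _ m hm)
      · rw [lie_eq_zero_of_simple_of_neg_simple hi hj hij hx hy, zero_lie]
        exact zero_mem _
  have htop : stabilizerOf L (negSpan b A) = ⊤ :=
    lieSubalgebra_eq_top_of_simple_rootSpaces b _ hH hpos isNegStable_negSpan
  let S : LieSubmodule K L M := { negSpan b A with
    lie_mem := fun {x m} hm ↦ (htop ▸ LieSubalgebra.mem_top x : x ∈ stabilizerOf L _) m hm }
  exact (LieSubmodule.lieSpan_le : _ ↔ A ⊆ S).mpr subset_negSpan

theorem isNegStable_iSup_weightSubmodule {T : Set (Module.Dual K H)}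
    (hT : ∀ l ∈ T, ∀ i ∈ b.support, l - (rootSystem H).root i ∈ T) :
    IsNegStable b (⨆ l ∈ T, weightSubmodule M l) := by
  intro i hi y hy
  change ⨆ l ∈ T, weightSubmodule M l ≤ (⨆ l ∈ T, weightSubmodule M l).comap (toEnd K L M y)
  exact iSup₂_le fun l hl m hm ↦ Submodule.mem_iSup_of_mem _
    (Submodule.mem_iSup_of_mem (hT l hl i hi) (IsWeightVec.lie_neg hm hy))

theorem IsWeightVec.exists_isWeightVec_add_of_negSpan_eq_top (hA : negSpan b A = ⊤)
    (hA' : ∀ a ∈ A, ∃ k : Module.Dual K H, IsWeightVec k a) {ν : Module.Dual K H} {w : M}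
    (hw : IsWeightVec ν w) (hw0 : w ≠ 0) :
    ∃ a ∈ A, a ≠ 0 ∧ ∃ p ∈ posCone b, IsWeightVec (ν + p) a := by
  let T : Set (Module.Dual K H) := {l | ∃ a ∈ A, a ≠ 0 ∧ ∃ p ∈ posCone b, IsWeightVec (l + p) a}
  have hle : negSpan b A ≤ ⨆ l ∈ T, weightSubmodule M l := by
    refine negSpan_le (fun a ha ↦ ?_) (isNegStable_iSup_weightSubmodule ?_)
    · obtain rfl | ha0 := eq_or_ne a 0
      · exact zero_mem _
      · obtain ⟨k, hk⟩ := hA' a ha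
        exact Submodule.mem_iSup_of_mem k (Submodule.mem_iSup_of_mem
          ⟨a, ha, ha0, 0, zero_mem _, by rwa [add_zero]⟩ hk)
    · rintro l ⟨a, ha, ha0, p, hp, hap⟩ i hi
      refine ⟨a, ha, ha0, (rootSystem H).root i + p, add_mem (root_mem_posCone hi) hp, ?_⟩
      rwa [← add_assoc, sub_add_cancel]
  by_contra hν
  exact hw0 (hw.eq_zero_of_mem_iSup (T := T) hν (hle (hA ▸ Submodule.mem_top)))

theorem IsWeightVec.exists_eq_smul_of_negSpan_eq_top {μ : Module.Dual K H} {v w : M}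
    (hw : IsWeightVec μ w) (hv : IsWeightVec μ v) (hA : negSpan b {v} = ⊤) :
    ∃ c : K, w = c • v := by
  let T : Set (Module.Dual K H) := {l | l ≠ μ ∧ ∃ p ∈ posCone b, l + p = μ}
  have hT {l p : Module.Dual K H} (hp : p ∈ posCone b) (hl : l + p = μ) {i : H.root}
      (hi : i ∈ b.support) : l - (rootSystem H).root i ∈ T := by
    refine ⟨fun h ↦ ?_, (rootSystem H).root i + p, add_mem (root_mem_posCone hi) hp, ?_⟩
    · have hip : (rootSystem H).root i + p = 0 := by
        rw [sub_eq_iff_eq_add.mp h] at hl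
        rwa [add_assoc, add_eq_left] at hl
      exact (rootSystem H).ne_zero i
        (eq_zero_of_add_eq_zero_of_mem_posCone (root_mem_posCone hi) hp hip)
    · rw [← add_assoc, sub_add_cancel, hl]
  let S := Submodule.span K {v} ⊔ ⨆ l ∈ T, weightSubmodule M l
  have hle : negSpan b {v} ≤ S := by
    refine negSpan_le (Submodule.subset_span.trans (SetLike.coe_subset_coe.mpr le_sup_left))
      fun i hi y hy ↦ ?_
    refine show S ≤ S.comap (toEnd K L M y) from
      sup_le ((Submodule.span_singleton_le_iff_mem _ _).mpr ?_) fun m hm ↦ ?_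
    · exact Submodule.mem_sup_right (Submodule.mem_iSup_of_mem _ (Submodule.mem_iSup_of_mem
        (hT (zero_mem _) (add_zero μ) hi) (hv.lie_neg hy)))
    · exact Submodule.mem_sup_right (isNegStable_iSup_weightSubmodule (T := T)
        (fun l ⟨_, p, hp, hl⟩ j hj ↦ hT hp hl hj) i hi y hy m hm)
  obtain ⟨a, ha, t, ht, rfl⟩ := Submodule.mem_sup.mp (hle (hA ▸ Submodule.mem_top : w ∈ _))
  obtain ⟨c, rfl⟩ := Submodule.mem_span_singleton.mp ha
  have htw : t ∈ weightSubmodule M μ :=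
    (Submodule.add_mem_iff_right _ (Submodule.smul_mem (weightSubmodule M μ) c hv)).mp hw
  exact ⟨c, by rw [IsWeightVec.eq_zero_of_mem_iSup (T := T) htw (fun h ↦ h.1 rfl) ht, add_zero]⟩

end NegSpan

/-! ### Finite-dimensional modules -/

section FiniteDimensionalModules

open LieAlgebra LieAlgebra.IsKilling LieModule

variable {K L M : Type*} [Field K] [LieRing L] [LieAlgebra K L]
  [AddCommGroup M] [Module K M] [LieRingModule L M] [LieModule K L M]

theorem exists_lieSubmodule_forall_ne_bot_mk_mem [IsNoetherian K M] {w : M} (hw : w ≠ 0) :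
    ∃ N : LieSubmodule K L M, w ∉ N ∧
      ∀ N' : LieSubmodule K L (M ⧸ N), N' ≠ ⊥ → LieSubmodule.Quotient.mk' N w ∈ N' := by
  obtain ⟨N, hN, hmax⟩ := WellFounded.has_min (wellFounded_gt (α := LieSubmodule K L M))
    {N | w ∉ N} ⟨⊥, by simpa using hw⟩
  refine ⟨N, hN, fun N' hN' ↦ ?_⟩
  by_contra hwN'
  have hle : N ≤ N'.comap (LieSubmodule.Quotient.mk' N) := fun n hn ↦ by
    rw [LieSubmodule.mem_comap, show LieSubmodule.Quotient.mk' N n = 0 from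
      LieSubmodule.Quotient.mk_eq_zero'.mpr hn]
    exact zero_mem N'
  refine hN' ((LieSubmodule.eq_bot_iff _).mpr fun q hq ↦ ?_)
  obtain ⟨m, rfl⟩ := LieSubmodule.Quotient.surjective_mk' N q
  have heq : N = N'.comap (LieSubmodule.Quotient.mk' N) :=
    hle.eq_of_not_lt (hmax (N'.comap (LieSubmodule.Quotient.mk' N)) hwN')
  exact LieSubmodule.Quotient.mk_eq_zero'.mpr (heq ▸ LieSubmodule.mem_comap.mpr hq)

variable [FiniteDimensional K L] {H : LieSubalgebra K L} [H.IsCartanSubalgebra]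
  [IsTriangularizable K H L] [CharZero K] [IsKilling K L] {b : (rootSystem H).Base}
  {ν ν' : Module.Dual K H} {w w' : M}

theorem IsSingular.casimirValue_eq_of_forall_ne_bot_mem (hw : IsSingular b ν w) (hw0 : w ≠ 0)
    (hw' : IsSingular b ν' w') (hw'0 : w' ≠ 0)
    (hmem : ∀ N : LieSubmodule K L M, N ≠ ⊥ → w ∈ N) :
    casimirValue b ν = casimirValue b ν' := by
  obtain ⟨d⟩ : Nonempty (DualRootVectors H) := inferInstance
  let Ω := casimir K M d.vec d.dualVec
  let N : LieSubmodule K L M :=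
    { Module.End.eigenspace Ω (casimirValue b ν') with
      lie_mem := fun {x m} hm ↦ by
        have hm' : Ω m = casimirValue b ν' • m := Module.End.mem_eigenspace_iff.mp hm
        refine Module.End.mem_eigenspace_iff.mpr ?_
        rw [← d.isKillingDual.lie_casimir, hm', lie_smul] }
  have hw'N : w' ∈ N := Module.End.mem_eigenspace_iff.mpr (d.casimir_of_isSingular hw')
  have hwN : Ω w = casimirValue b ν' • w := Module.End.mem_eigenspace_iff.mp
    (hmem N fun h ↦ hw'0 ((LieSubmodule.mem_bot w').mp (h ▸ hw'N)))
  exact smul_left_injective K hw0 ((d.casimir_of_isSingular hw).symm.trans hwN)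

variable [FiniteDimensional K M]

/- The eigenvalues on `M` of an element of `H` that takes the value one on the simple roots are
finite in number, so a weight vector of maximal height exists. -/
theorem IsWeightVec.exists_isSingular_add {k : Module.Dual K H} {m : M} (hm : IsWeightVec k m)
    (hm0 : m ≠ 0) (b : (rootSystem H).Base) :
    ∃ p ∈ posCone b, ∃ w : M, w ≠ 0 ∧ IsSingular b (k + p) w := by
  let S : Set ℕ :=
    {n | ∃ p ∈ posCone b, height b p = n ∧ ∃ w : M, w ≠ 0 ∧ IsWeightVec (k + p) w}
  have hfin : S.Finite := by
    let x : H := (Module.evalEquiv K H).symm (height b)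
    have hinj : Function.Injective fun n : ℕ ↦ k x + (n : K) := fun m n h ↦ by
      exact_mod_cast add_left_cancel h
    refine ((Module.End.finite_hasEigenvalue (toEnd K L M (x : L))).preimage
      hinj.injOn).subset ?_
    rintro n ⟨p, -, hpn, w, hw0, hw⟩
    refine Module.End.hasEigenvalue_of_hasEigenvector (x := w) ⟨?_, hw0⟩
    rw [Module.End.mem_eigenspace_iff, toEnd_apply_apply, hw x, LinearMap.add_apply,
      Module.apply_evalEquiv_symm_apply K H p, hpn]
  obtain ⟨n, ⟨p, hp, hpn, w, hw0, hw⟩, hmax⟩ :=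
    hfin.exists_maximal ⟨0, 0, zero_mem _, by simp, m, hm0, by rwa [add_zero]⟩
  refine ⟨p, hp, w, hw0, hw, fun i hi y hy ↦ ?_⟩
  by_contra hyw
  have hsucc : n + 1 ∈ S := by
    refine ⟨p + (rootSystem H).root i, add_mem hp (root_mem_posCone hi), ?_, _, hyw, ?_⟩
    · rw [map_add, hpn, height_root hi, Nat.cast_succ]
    · rw [← add_assoc]
      exact hw.lie hy
  exact absurd (hmax hsucc n.le_succ) n.lt_irrefl

theorem IsSingular.exists_apply_coroot_eq (hw : IsSingular b ν w) (hw0 : w ≠ 0) {i : H.root}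
    (hi : i ∈ b.support) :
    ∃ n : ℕ, ν ((rootSystem H).coroot i) = n ∧ ∀ y ∈ rootSpace H (-(i.1 : H → K)),
      (toEnd K L M y ^ (n + 1)) w = 0 := by
  have hα : i.1.IsNonZero := LieSubalgebra.isNonZero_coe_root i
  obtain ⟨h, e, f, ht, he, hf⟩ := exists_isSl2Triple_of_weight_isNonZero hα
  have prim : ht.HasPrimitiveVectorWith w (ν (coroot i.1)) := by
    refine ⟨hw0, ?_, hw.lie_eq_zero i hi e he⟩
    rw [ht.h_eq_coroot hα he hf]
    exact hw.isWeightVec _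
  obtain ⟨n, hn⟩ := prim.exists_nat
  refine ⟨n, hn, fun y hy ↦ ?_⟩
  have hf0 : (⟨f, hf⟩ : rootSpace H (-i.1 : Weight K H L)) ≠ 0 := fun h ↦
    ht.f_ne_zero (congrArg Subtype.val h)
  obtain ⟨c, hc⟩ := (finrank_eq_one_iff_of_nonzero' _ hf0).mp
    (finrank_rootSpace_eq_one _ hα.neg) ⟨y, hy⟩
  have hc' : c • f = y := congrArg Subtype.val hc
  rw [← hc', map_smul, smul_pow, LinearMap.smul_apply, prim.pow_toEnd_f_eq_zero_of_eq_nat hn,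
    smul_zero]

theorem IsSingular.isDominantIntegral (hw : IsSingular b ν w) (hw0 : w ≠ 0) :
    IsDominantIntegral b ν := fun _ hi ↦
  (hw.exists_apply_coroot_eq hw0 hi).imp fun _ ↦ And.left

variable {A : Set M}

theorem IsSingular.exists_isWeightVec_of_forall_ne_bot_mem (hw : IsSingular b ν w) (hw0 : w ≠ 0)
    (hA : negSpan b A = ⊤) (hA' : ∀ a ∈ A, ∃ k : Module.Dual K H, IsWeightVec k a)
    (hmem : ∀ N : LieSubmodule K L M, N ≠ ⊥ → w ∈ N) :
    ∃ a ∈ A, a ≠ 0 ∧ IsWeightVec ν a := by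
  obtain ⟨a, ha, ha0, p, hp, hpa⟩ :=
    hw.isWeightVec.exists_isWeightVec_add_of_negSpan_eq_top hA hA' hw0
  obtain ⟨q, hq, w', hw'0, hw'⟩ := hpa.exists_isSingular_add ha0 b
  rw [add_assoc] at hw'
  have hpq : p + q = 0 := eq_zero_of_casimirValue_add_eq (add_mem hp hq)
    (hw.isDominantIntegral hw0) (hw'.isDominantIntegral hw'0)
    (hw.casimirValue_eq_of_forall_ne_bot_mem hw0 hw' hw'0 hmem).symm
  rw [eq_zero_of_add_eq_zero_of_mem_posCone hp hq hpq, add_zero] at hpa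
  exact ⟨a, ha, ha0, hpa⟩

/- This replaces complete reducibility: pass to a quotient in which `w` generates the unique simple
submodule. There the Casimir operator forces all singular vectors above `w` to have weight `ν`. -/
theorem IsSingular.exists_isWeightVec_of_negSpan_eq_top (hw : IsSingular b ν w) (hw0 : w ≠ 0)
    (hA : negSpan b A = ⊤) (hA' : ∀ a ∈ A, ∃ k : Module.Dual K H, IsWeightVec k a) :
    ∃ a ∈ A, a ≠ 0 ∧ IsWeightVec ν a := by
  obtain ⟨N, hwN, hmem⟩ := exists_lieSubmodule_forall_ne_bot_mk_mem (K := K) (L := L) hw0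
  let π := LieSubmodule.Quotient.mk' N
  have hπ : Function.Surjective π := LieSubmodule.Quotient.surjective_mk' N
  have hfin : FiniteDimensional K (M ⧸ N) :=
    Module.Finite.of_surjective (π : M →ₗ[K] M ⧸ N) hπ
  obtain ⟨_, ⟨a, ha, rfl⟩, hπa, hνa⟩ :=
    (hw.map π).exists_isWeightVec_of_forall_ne_bot_mem
      (fun h ↦ hwN (LieSubmodule.Quotient.mk_eq_zero'.mp h))
      (by rw [← map_negSpan, hA, Submodule.map_top, LinearMap.range_eq_top.mpr hπ])
      (Set.forall_mem_image.mpr fun a ha ↦ (hA' a ha).imp fun _ hk ↦ hk.map π) hmem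
  obtain ⟨k, hk⟩ := hA' a ha
  obtain rfl : k = ν := (hk.map π).eq_of_ne_zero hνa hπa
  exact ⟨a, ha, fun h ↦ hπa (by rw [h, map_zero]), hk⟩

end FiniteDimensionalModules

/-! ### Highest weight modules and the simple modules -/

section HighestWeight

open LieAlgebra LieAlgebra.IsKilling LieModule

variable {K L M N : Type*} [Field K] [LieRing L] [AddCommGroup M] [Module K M] [LieRingModule L M]
  [AddCommGroup N] [Module K N] [LieRingModule L N]

theorem map_lieSpan (A : Set M) (f : M →ₗ⁅K,L⁆ N) :
    (LieSubmodule.lieSpan K L A).map f = LieSubmodule.lieSpan K L (f '' A) := by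
  refine le_antisymm (LieSubmodule.map_le_iff_le_comap.mpr (LieSubmodule.lieSpan_le.mpr ?_))
    (LieSubmodule.lieSpan_le.mpr ?_)
  · exact fun a ha ↦ LieSubmodule.subset_lieSpan ⟨a, ha, rfl⟩
  · rintro _ ⟨a, ha, rfl⟩
    exact LieSubmodule.mem_map_of_mem (LieSubmodule.subset_lieSpan ha)

theorem eq_zero_of_lieSpan_eq_top {v : M} (hv : LieSubmodule.lieSpan K L {v} = ⊤)
    {f : M →ₗ⁅K,L⁆ N} (hfv : f v = 0) : f = 0 := by
  have hle : LieSubmodule.lieSpan K L {v} ≤ f.ker :=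
    LieSubmodule.lieSpan_le.mpr (Set.singleton_subset_iff.mpr (f.mem_ker.mpr hfv))
  rw [hv] at hle
  exact LieModuleHom.ext fun m ↦ f.mem_ker.mp (hle (LieSubmodule.mem_top m))

variable [CharZero K] [LieAlgebra K L] [LieModule K L M] [FiniteDimensional K L] [IsKilling K L]
  {H : LieSubalgebra K L} [H.IsCartanSubalgebra] {μ : Module.Dual K H} {v : M}

theorem exists_isSingular [IsTriangularizable K H L] [IsTriangularizable K H M]
    [FiniteDimensional K M] [Nontrivial M] (b : (rootSystem H).Base) :
    ∃ (ν : Module.Dual K H) (w : M), w ≠ 0 ∧ IsSingular b ν w := by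
  obtain ⟨χ, hχ⟩ := exists_nontrivial_weightSpace_of_isSolvable K H M
  obtain ⟨⟨m, hm⟩, hm0⟩ := exists_ne (0 : weightSpace M χ)
  obtain ⟨p, -, hw⟩ := IsWeightVec.exists_isSingular_add ((mem_weightSpace (χ : H → K) m).mp hm)
    (fun h ↦ hm0 (Subtype.ext h)) b
  exact ⟨χ + p, hw⟩

variable [IsAlgClosed K] {b : (rootSystem H).Base}

/- A singular vector of a nonzero submodule has the weight of the generator, and the corresponding
weight space is one-dimensional. -/
theorem IsSingular.mem_of_lieSpan_eq_top [FiniteDimensional K M] (hv : IsSingular b μ v)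
    (hspan : LieSubmodule.lieSpan K L {v} = ⊤) {I : LieSubmodule K L M} (hI : I ≠ ⊥) : v ∈ I := by
  have hneg : negSpan b {v} = ⊤ := by
    rw [negSpan_eq_lieSpan (by rintro _ rfl; exact ⟨μ, hv⟩), hspan,
      LieSubmodule.top_toSubmodule]
  have : Nontrivial I := (LieSubmodule.nontrivial_iff_ne_bot K L M).mpr hI
  obtain ⟨ν, ⟨w, hwI⟩, hw0, hw⟩ := exists_isSingular (M := I) b
  replace hw : IsSingular b ν w := hw.map I.incl
  replace hw0 : w ≠ 0 := fun h ↦ hw0 (Subtype.ext h)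
  obtain ⟨_, rfl, hv0, hνv⟩ := hw.exists_isWeightVec_of_negSpan_eq_top hw0 hneg
    (by rintro _ rfl; exact ⟨μ, hv.isWeightVec⟩)
  obtain rfl := hνv.eq_of_ne_zero hv.isWeightVec hv0
  obtain ⟨c, rfl⟩ := hw.isWeightVec.exists_eq_smul_of_negSpan_eq_top hνv hneg
  exact (I.toSubmodule.smul_mem_iff (left_ne_zero_of_smul hw0)).mp hwI

theorem IsSingular.le_of_finiteDimensional_quotient (hv : IsSingular b μ v)
    (hspan : LieSubmodule.lieSpan K L {v} = ⊤) (N₁ N₂ : LieSubmodule K L M)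
    [FiniteDimensional K (M ⧸ N₁)] [FiniteDimensional K (M ⧸ N₂)] (h₁ : N₁ ≠ ⊤) : N₁ ≤ N₂ := by
  let π := LieSubmodule.Quotient.mk' (N₁ ⊓ N₂)
  have hfd : FiniteDimensional K (M ⧸ N₁ ⊓ N₂) :=
    Submodule.CoFG.inf (S := N₁.toSubmodule) (T := N₂.toSubmodule) ‹_› ‹_›
  have hspan' : LieSubmodule.lieSpan K L {π v} = ⊤ := by
    rw [← Set.image_singleton, ← map_lieSpan, hspan, LieModuleHom.map_top,
      LieSubmodule.Quotient.range_mk']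
  by_contra hle
  have hne : N₁.map π ≠ ⊥ := fun h ↦
    hle ((LieSubmodule.Quotient.map_mk'_eq_bot_le _ _).mp h |>.trans inf_le_right)
  obtain ⟨n, hn, hnv⟩ := (LieSubmodule.mem_map _).mp ((hv.map π).mem_of_lieSpan_eq_top hspan' hne)
  have hsub : v - n ∈ N₁ ⊓ N₂ := LieSubmodule.Quotient.mk_eq_zero'.mp (by
    rw [← LieSubmodule.Quotient.mk'_apply, map_sub, hnv, sub_self])
  refine h₁ (eq_top_iff.mpr (hspan ▸ LieSubmodule.lieSpan_le.mpr ?_))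
  exact Set.singleton_subset_iff.mpr (by simpa using add_mem hsub.1 hn)

theorem IsSingular.finiteDimensional_quotient_sInf (hv : IsSingular b μ v)
    (hspan : LieSubmodule.lieSpan K L {v} = ⊤) {S : Set (LieSubmodule K L M)}
    (hS : ∀ N ∈ S, FiniteDimensional K (M ⧸ N)) : FiniteDimensional K (M ⧸ sInf S) := by
  by_cases! h_top : ∀ N ∈ S, N = ⊤
  · rw [sInf_eq_top.mpr h_top]
    have : Subsingleton (M ⧸ (⊤ : LieSubmodule K L M)) :=
      Submodule.Quotient.subsingleton_iff.mpr rfl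
    infer_instance
  · obtain ⟨N₀, hN₀, hne⟩ := h_top
    have hfd₀ := hS N₀ hN₀
    have h_least (N) (hN : N ∈ S) : N₀ ≤ N := by
      have hfd := hS N hN
      exact hv.le_of_finiteDimensional_quotient hspan N₀ N hne
    rwa [(sInf_le hN₀).antisymm (le_sInf h_least)]

end HighestWeight

namespace SimpleModule

open LieAlgebra LieAlgebra.IsKilling LieModule

variable {𝔤 : Type u} [LieRing 𝔤] [LieAlgebra ℂ 𝔤] [FiniteDimensional ℂ 𝔤]
  [LieAlgebra.IsSimple ℂ 𝔤] {𝔥 : LieSubalgebra ℂ 𝔤} [𝔥.IsCartanSubalgebra]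
  {b : (rootSystem 𝔥).Base} (μ : DominantWeight b)

/-- The projection of the enveloping algebra onto its quotient `V(μ)`; the image of `1` is the
generator `v_μ`. -/
def mk : UEnv 𝔤 →ₗ[UEnv 𝔤] SimpleModule μ := (simpleModuleRel μ).mkQ

theorem mk_surjective : Function.Surjective (mk μ) := (simpleModuleRel μ).mkQ_surjective

theorem lie_mk (x : 𝔤) (u : UEnv 𝔤) : ⁅x, mk μ u⁆ = mk μ (UEnv.ι x * u) := rfl

variable {μ} in
theorem mk_eq_zero {u : UEnv 𝔤} (hu : u ∈ simpleModuleRel μ) : mk μ u = 0 :=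
  (Submodule.Quotient.mk_eq_zero _).mpr hu

theorem isSingular_mk_one : IsSingular b μ.1 (mk μ 1) := by
  refine ⟨fun h ↦ ?_, fun i hi x hx ↦ ?_⟩
  · have hh := mk_eq_zero (u := UEnv.ι (h : 𝔤) - algebraMap ℂ (UEnv 𝔤) (μ.1 h))
      (Submodule.subset_span (Or.inl (Or.inl ⟨h, rfl⟩)))
    rw [map_sub, sub_eq_zero] at hh
    rw [lie_mk, mul_one, hh, ← mul_one (algebraMap ℂ (UEnv 𝔤) (μ.1 h)), ← smul_eq_mul, map_smul,
      algebraMap_smul]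
  · rw [lie_mk, mul_one]
    exact mk_eq_zero (Submodule.subset_span (Or.inl (Or.inr ⟨i, hi, x, hx, rfl⟩)))

theorem lieSpan_mk_one : LieSubmodule.lieSpan ℂ 𝔤 {mk μ 1} = ⊤ := by
  let N := LieSubmodule.lieSpan ℂ 𝔤 {mk μ 1}
  have hN : N.toSubmodule.comap ((mk μ).restrictScalars ℂ) = ⊤ :=
    UEnv.eq_top_of_one_mem _ (LieSubmodule.subset_lieSpan rfl) fun x _ hu ↦
      N.lie_mem (x := x) hu
  refine eq_top_iff.mpr fun m _ ↦ ?_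
  obtain ⟨u, rfl⟩ := mk_surjective μ m
  exact Submodule.mem_comap.mp (hN ▸ Submodule.mem_top : u ∈ _)

section Hom

attribute [local instance 100] LieRing.ofAssociativeRing

variable {M : Type*} [AddCommGroup M] [Module ℂ M] [LieRingModule 𝔤 M] [LieModule ℂ 𝔤 M]
  [FiniteDimensional ℂ M] {μ} {w : M}

theorem lift_toEnd_apply_eq_zero (hw : IsSingular b μ.1 w) {u : UEnv 𝔤}
    (hu : u ∈ simpleModuleRel μ) :
    UniversalEnvelopingAlgebra.lift ℂ (toEnd ℂ 𝔤 M) u w = 0 := by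
  obtain rfl | hw0 := eq_or_ne w 0
  · exact map_zero _
  have hι (x : 𝔤) : UniversalEnvelopingAlgebra.lift ℂ (toEnd ℂ 𝔤 M) (UEnv.ι x) = toEnd ℂ 𝔤 M x :=
    UniversalEnvelopingAlgebra.lift_ι_apply ℂ (toEnd ℂ 𝔤 M) x
  induction hu using Submodule.span_induction with
  | mem u hu =>
    rcases hu with (⟨h, rfl⟩ | ⟨i, hi, x, hx, rfl⟩) | ⟨i, hi, y, hy, n, hn, rfl⟩
    · rw [map_sub, hι, AlgHom.commutes, LinearMap.sub_apply, toEnd_apply_apply,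
        hw.isWeightVec h, Module.algebraMap_end_apply, sub_self]
    · rw [hι, toEnd_apply_apply, hw.lie_eq_zero i hi x hx]
    · obtain ⟨n', hn', hpow⟩ := hw.exists_apply_coroot_eq hw0 hi
      obtain rfl : n' = n := Nat.cast_injective (hn'.symm.trans hn)
      rw [map_pow, hι, hpow y hy]
  | zero => rw [map_zero, LinearMap.zero_apply]
  | add u v _ _ hu hv => rw [map_add, LinearMap.add_apply, hu, hv, add_zero]
  | smul c u _ hu => rw [smul_eq_mul, map_mul, Module.End.mul_apply, hu, map_zero]

theorem exists_hom_of_isSingular (hw : IsSingular b μ.1 w) :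
    ∃ φ : SimpleModule μ →ₗ⁅ℂ,𝔤⁆ M, φ (mk μ 1) = w := by
  let ρ := UniversalEnvelopingAlgebra.lift ℂ (toEnd ℂ 𝔤 M)
  let φ : SimpleModule μ →ₗ[ℂ] M := ((simpleModuleRel μ).restrictScalars ℂ).liftQ
    ((LinearMap.applyₗ w).comp ρ.toLinearMap) fun _ hu ↦ lift_toEnd_apply_eq_zero hw hu
  have hφ (u : UEnv 𝔤) : φ (mk μ u) = ρ u w := rfl
  refine ⟨{ φ with map_lie' := fun {x m} ↦ ?_ }, ?_⟩
  · obtain ⟨u, rfl⟩ := mk_surjective μ m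
    change φ ⁅x, mk μ u⁆ = ⁅x, φ (mk μ u)⁆
    rw [lie_mk, hφ, hφ, map_mul, Module.End.mul_apply]
    exact congrArg (· (ρ u w)) (UniversalEnvelopingAlgebra.lift_ι_apply ℂ (toEnd ℂ 𝔤 M) x)
  · change φ (mk μ 1) = w
    rw [hφ, map_one, Module.End.one_apply]

end Hom

end SimpleModule

/-! ### Graded modules: shifts and quotients -/

section Graded

variable {𝔤 : Type u} [LieRing 𝔤] [LieAlgebra ℂ 𝔤]

theorem iSup_inf_shift {R M : Type*} [Semiring R] [AddCommMonoid M] [Module R M] (r : ℕ)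
    (gr : ℕ → Submodule R M) (N : Submodule R M) :
    ⨆ k, N ⊓ (if r ≤ k then gr (k - r) else ⊥) = ⨆ k, N ⊓ gr k := by
  refine le_antisymm (iSup_le fun k ↦ ?_) (iSup_le fun k ↦ le_iSup_of_le (k + r) ?_)
  · split_ifs
    · exact le_iSup (fun k ↦ N ⊓ gr k) (k - r)
    · rw [inf_bot_eq]
      exact bot_le
  · rw [if_pos (Nat.le_add_left r k), Nat.add_sub_cancel]

theorem AdExt.lie_inl_ad (x y : 𝔤) : ⁅AdExt.inl x, AdExt.ad y⁆ = AdExt.ad ⁅x, y⁆ := by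
  ext
  · exact lie_zero x
  · change ⁅x, y⁆ + ⁅(0 : 𝔤), (0 : 𝔤)⁆ = ⁅x, y⁆
    rw [lie_zero, add_zero]

namespace GradedLieMod

variable (V : GradedLieMod 𝔤)

instance : LieRingModule 𝔤 V.carrier := LieRingModule.compLieHom V.carrier AdExt.inl

instance : LieModule ℂ 𝔤 V.carrier := LieModule.compLieHom V.carrier AdExt.inl

theorem lie_ad_lie (x y : 𝔤) (m : V.carrier) :
    ⁅x, ⁅AdExt.ad y, m⁆⁆ = ⁅AdExt.ad ⁅x, y⁆, m⁆ + ⁅AdExt.ad y, ⁅x, m⁆⁆ := by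
  change ⁅AdExt.inl x, ⁅AdExt.ad y, m⁆⁆ = _ + ⁅AdExt.ad y, ⁅AdExt.inl x, m⁆⁆
  rw [leibniz_lie, AdExt.lie_inl_ad]

/-- The inclusion of a graded piece, as a homomorphism of `𝔤`-modules. -/
def grIncl (k : ℕ) : V.gr k →ₗ⁅ℂ,𝔤⁆ V.carrier where
  __ := (V.gr k).subtype
  map_lie' := rfl

variable (r : ℕ)

theorem shiftObj_gr_add (k : ℕ) : (shiftObj r V).gr (k + r) = V.gr k := by
  change (if r ≤ k + r then V.gr (k + r - r) else ⊥) = V.gr k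
  rw [if_pos (Nat.le_add_left r k), Nat.add_sub_cancel]

theorem shiftObj_gr_of_lt {k : ℕ} (hk : k < r) : (shiftObj r V).gr k = ⊥ :=
  if_neg (not_le.mpr hk)

theorem g2_shiftObj : G2 (shiftObj r V) ↔ G2 V := by
  refine ⟨fun h k ↦ shiftObj_gr_add V r k ▸ h (k + r), fun h k ↦ ?_⟩
  obtain hk | hk := lt_or_ge k r
  · rw [shiftObj_gr_of_lt V r hk]
    exact Module.Finite.bot ℂ _
  · obtain ⟨j, rfl⟩ := Nat.exists_eq_add_of_le' hk
    rw [shiftObj_gr_add]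
    exact h j

variable (K : LieSubmodule ℂ (AdExt 𝔤) V.carrier)

theorem isGraded_iff_le_iSup : V.IsGraded K ↔ K.toSubmodule ≤ ⨆ k, K.toSubmodule ⊓ V.gr k := by
  refine ⟨fun hK v hv ↦ ?_, fun hK v hv k ↦ ?_⟩
  · classical
    let := V.isInternal.chooseDecomposition
    rw [← DirectSum.sum_support_decompose V.gr v]
    exact sum_mem fun k _ ↦ Submodule.mem_iSup_of_mem k
      ⟨hK v hv k, (DirectSum.decompose V.gr v k).2⟩
  · replace hv := hK hv
    induction hv using Submodule.iSup_induction' with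
    | mem j v hv =>
      obtain rfl | hjk := eq_or_ne j k
      · rw [V.proj_of_mem hv.2]
        exact hv.1
      · rw [V.proj_of_mem_ne hv.2 hjk]
        exact zero_mem K
    | zero =>
      rw [V.proj_of_mem_ne (Submodule.zero_mem (V.gr (k + 1))) k.succ_ne_self]
      exact zero_mem K
    | add v w _ _ hv hw =>
      rw [proj_add]
      exact add_mem hv hw

theorem isGraded_shiftObj : (shiftObj r V).IsGraded K ↔ V.IsGraded K := by
  rw [isGraded_iff_le_iSup V K, ← iSup_inf_shift r V.gr K.toSubmodule]
  exact isGraded_iff_le_iSup (shiftObj r V) K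

theorem quotient_shiftObj (hK : V.IsGraded K) :
    (shiftObj r V).quotient K ((isGraded_shiftObj V r K).mpr hK) =
      shiftObj r (V.quotient K hK) := by
  let π : V.carrier →ₗ[ℂ] V.carrier ⧸ K := LieSubmodule.Quotient.mk' K
  have hgr (k : ℕ) : (if r ≤ k then V.gr (k - r) else ⊥).map π =
      if r ≤ k then (V.gr (k - r)).map π else ⊥ := by
    rw [apply_ite (Submodule.map π), Submodule.map_bot]
  unfold quotient
  congr
  exact funext hgr

variable {K}

/-- The projection onto a quotient, as a homomorphism of `𝔤`-modules. -/
def quotientMap (hK : V.IsGraded K) : V.carrier →ₗ⁅ℂ,𝔤⁆ (V.quotient K hK).carrier where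
  __ := (LieSubmodule.Quotient.mk' K : V.carrier →ₗ[ℂ] V.carrier ⧸ K)
  map_lie' := fun {x m} ↦ LieModuleHom.map_lie (LieSubmodule.Quotient.mk' K) (AdExt.inl x) m

variable (hK : V.IsGraded K)

theorem quotientMap_eq_zero_iff {m : V.carrier} : V.quotientMap hK m = 0 ↔ m ∈ K :=
  LieSubmodule.Quotient.mk_eq_zero'

theorem quotientMap_lie (x : AdExt 𝔤) (m : V.carrier) :
    V.quotientMap hK ⁅x, m⁆ = ⁅x, V.quotientMap hK m⁆ :=
  LieModuleHom.map_lie (LieSubmodule.Quotient.mk' K) x m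

theorem mem_gr_quotient {k : ℕ} {m : (V.quotient K hK).carrier} :
    m ∈ (V.quotient K hK).gr k ↔ ∃ v ∈ V.gr k, V.quotientMap hK v = m := Iff.rfl

end GradedLieMod

end Graded

/-! ### Truncations -/

section SingularKernels

open LieAlgebra LieAlgebra.IsKilling

variable {K L M N P : Type*} [Field K] [LieRing L] [LieAlgebra K L] {H : LieSubalgebra K L}
  [FiniteDimensional K L] [H.IsCartanSubalgebra] [LieModule.IsTriangularizable K H L] [CharZero K]
  [IsKilling K L] [AddCommGroup M] [Module K M] [LieRingModule L M]
  [AddCommGroup N] [Module K N] [LieRingModule L N]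
  [AddCommGroup P] [Module K P] [LieRingModule L P]
  {b : (rootSystem H).Base} {k : Module.Dual K H}

theorem IsSingular.of_ker_le {f : M →ₗ⁅K,L⁆ N} {g : M →ₗ⁅K,L⁆ P}
    (hfg : ∀ m, f m = 0 → g m = 0) {m : M} (hm : IsSingular b k (f m)) : IsSingular b k (g m) := by
  refine ⟨fun h ↦ ?_, fun i hi x hx ↦ ?_⟩
  · rw [← sub_eq_zero, ← LieModuleHom.map_lie, ← map_smul, ← map_sub]
    refine hfg _ ?_
    rw [map_sub, map_smul, LieModuleHom.map_lie, hm.isWeightVec h, sub_self]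
  · rw [← LieModuleHom.map_lie]
    refine hfg _ ?_
    rw [LieModuleHom.map_lie, hm.lie_eq_zero i hi x hx]

end SingularKernels

section Truncation

open LieAlgebra LieAlgebra.IsKilling LieModule GradedLieMod

variable {𝔤 : Type u} [LieRing 𝔤] [LieAlgebra ℂ 𝔤] [FiniteDimensional ℂ 𝔤]
  [LieAlgebra.IsSimple ℂ 𝔤] {𝔥 : LieSubalgebra ℂ 𝔤} [𝔥.IsCartanSubalgebra]
  {b : (rootSystem 𝔥).Base} {V : GradedLieMod 𝔤}

theorem isSingular_coe_iff {k : ℕ} {ν : Module.Dual ℂ 𝔥} {w : V.gr k} :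
    IsSingular b ν (w : V.carrier) ↔ IsSingular b ν w :=
  ⟨fun h ↦ ⟨fun t ↦ Subtype.ext (h.isWeightVec t),
    fun i hi x hx ↦ Subtype.ext (h.lie_eq_zero i hi x hx)⟩, fun h ↦ h.map (V.grIncl k)⟩

theorem simpleMultiplicity_ne_zero_iff {p : DominantWeight b × ℕ} [FiniteDimensional ℂ (V.gr p.2)] :
    simpleMultiplicity V p ≠ 0 ↔
      ∃ w ∈ V.gr p.2, w ≠ 0 ∧ IsSingular b p.1.1 (w : V.carrier) := by
  rw [simpleMultiplicity, Ne, rank_zero_iff, not_subsingleton_iff_nontrivial]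
  refine ⟨fun _ ↦ ?_, fun ⟨w, hw, hw0, hs⟩ ↦ ?_⟩
  · obtain ⟨φ, hφ⟩ := exists_ne (0 : SimpleModule p.1 →ₗ⁅ℂ,𝔤⁆ V.gr p.2)
    refine ⟨φ (SimpleModule.mk p.1 1), (φ (SimpleModule.mk p.1 1)).2, fun h0 ↦ hφ ?_,
      isSingular_coe_iff.mpr ((SimpleModule.isSingular_mk_one p.1).map φ)⟩
    exact eq_zero_of_lieSpan_eq_top (SimpleModule.lieSpan_mk_one p.1) (Subtype.ext h0)
  · obtain ⟨φ, hφ⟩ := SimpleModule.exists_hom_of_isSingular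
      (isSingular_coe_iff.mp hs : IsSingular b p.1.1 (⟨w, hw⟩ : V.gr p.2))
    exact ⟨φ, 0, fun h ↦ hw0 (congrArg Subtype.val (h ▸ hφ)).symm⟩

variable {Γ Γ' : Set (DominantWeight b × ℕ)}

theorem g2Gamma_iff : G2Gamma Γ V ↔ G2 V ∧ ∀ (ν : DominantWeight b) (s : ℕ), ∀ w ∈ V.gr s,
    w ≠ 0 → IsSingular b ν.1 (w : V.carrier) → (ν, s) ∈ Γ := by
  refine and_congr_right fun hfd ↦ ⟨fun h ν s w hw hw0 hs ↦ ?_, fun h p hp ↦ ?_⟩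
  · have := hfd s
    exact h (ν, s) (simpleMultiplicity_ne_zero_iff.mpr ⟨w, hw, hw0, hs⟩)
  · have := hfd p.2
    obtain ⟨w, hw, hw0, hs⟩ := simpleMultiplicity_ne_zero_iff.mp hp
    exact h p.1 p.2 w hw hw0 hs

/-- The set of the pairs `(ν, s)` with `(ν, s + r) ∈ Γ`; it describes the objects whose shift by
`r` lies in `𝒢₂[Γ]`. -/
def shiftDown (r : ℕ) (Γ : Set (DominantWeight b × ℕ)) : Set (DominantWeight b × ℕ) :=
  {p | (p.1, p.2 + r) ∈ Γ}

theorem g2Gamma_shiftObj_iff (r : ℕ) :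
    G2Gamma Γ (shiftObj r V) ↔ G2Gamma (shiftDown r Γ) V := by
  rw [g2Gamma_iff, g2Gamma_iff, g2_shiftObj]
  refine and_congr_right fun _ ↦ ⟨fun h ν s w hw ↦ ?_, fun h ν s w hw hw0 ↦ ?_⟩
  · exact h ν (s + r) w ((shiftObj_gr_add V r s).symm ▸ hw)
  · obtain hs | hs := lt_or_ge s r
    · rw [shiftObj_gr_of_lt V r hs] at hw
      exact absurd hw hw0
    · obtain ⟨j, rfl⟩ := Nat.exists_eq_add_of_le' hs
      rw [shiftObj_gr_add] at hw
      exact h ν j w hw hw0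

variable (Γ V) in
theorem truncationKernels_shiftObj (r : ℕ) :
    truncationKernels Γ (shiftObj r V) = truncationKernels (shiftDown r Γ) V := by
  ext K
  refine ⟨fun ⟨hK, h⟩ ↦ ⟨(isGraded_shiftObj V r K).mp hK, ?_⟩,
    fun ⟨hK, h⟩ ↦ ⟨(isGraded_shiftObj V r K).mpr hK, ?_⟩⟩
  · exact (g2Gamma_shiftObj_iff r).mp (quotient_shiftObj V r K _ ▸ h)
  · have h_quot := quotient_shiftObj V r K hK
    exact h_quot ▸ (g2Gamma_shiftObj_iff r).mpr h

theorem truncation_congr (h : truncationKernels Γ V = truncationKernels Γ' V) :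
    truncation Γ V = truncation Γ' V := by
  unfold truncation
  congr

variable (Γ V) in
theorem truncation_shiftObj (r : ℕ) :
    truncation Γ (shiftObj r V) = shiftObj r (truncation (shiftDown r Γ) V) := by
  have hgr := V.isGraded_sInf (truncationKernels (shiftDown r Γ) V) fun _ hK ↦ hK.1
  refine Eq.trans ?_ (quotient_shiftObj V r _ hgr)
  unfold truncation
  congr 2
  exact truncationKernels_shiftObj V Γ r

theorem g2Gamma_truncation (hfd : G2 (truncation Γ V)) : G2Gamma Γ (truncation Γ V) := by
  refine g2Gamma_iff.mpr ⟨hfd, ?_⟩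
  rintro ν s _ ⟨m, hm, rfl⟩ hw0 hs
  have hgr := V.isGraded_sInf (truncationKernels Γ V) fun _ hK ↦ hK.1
  have hmem : m ∉ sInf (truncationKernels Γ V) := fun h ↦
    hw0 ((V.quotientMap_eq_zero_iff hgr).mpr h)
  obtain ⟨K, hK, hmK⟩ : ∃ K ∈ truncationKernels Γ V, m ∉ K := by
    by_contra! h
    rw [← SetLike.mem_coe, LieSubmodule.coe_sInf, Set.mem_iInter₂] at hmem
    exact hmem h
  have ⟨hKgr, hKΓ⟩ := hK
  refine (g2Gamma_iff.mp hKΓ).2 ν s (V.quotientMap hKgr m) ⟨m, hm, rfl⟩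
    (fun h ↦ hmK ((V.quotientMap_eq_zero_iff hKgr).mp h)) ?_
  refine IsSingular.of_ker_le (f := V.quotientMap hgr) (fun v hv ↦ ?_) hs
  rw [quotientMap_eq_zero_iff] at hv ⊢
  exact sInf_le hK hv

end Truncation

/-! ### Generation in degree zero -/

section Generation

open LieModule GradedLieMod

variable {𝔤 : Type u} [LieRing 𝔤] [LieAlgebra ℂ 𝔤]

namespace GradedLieMod

variable (V : GradedLieMod 𝔤)

/-- The action of `𝔤_ad` on a graded module. -/
def adAction : 𝔤 →ₗ[ℂ] Module.End ℂ V.carrier :=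
  (toEnd ℂ (AdExt 𝔤) V.carrier : AdExt 𝔤 →ₗ[ℂ] Module.End ℂ V.carrier).comp AdExt.ad

variable {V} in
theorem lie_mem_map₂_adAction {k : ℕ} {m : V.carrier} (x : 𝔤)
    (hm : m ∈ Submodule.map₂ V.adAction ⊤ (V.gr k)) :
    ⁅x, m⁆ ∈ Submodule.map₂ V.adAction ⊤ (V.gr k) := by
  have hle : Submodule.map₂ V.adAction ⊤ (V.gr k) ≤
      (Submodule.map₂ V.adAction ⊤ (V.gr k)).comap (toEnd ℂ 𝔤 V.carrier x) := by
    refine Submodule.map₂_le.mpr fun y _ n hn ↦ ?_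
    change ⁅x, ⁅AdExt.ad y, n⁆⁆ ∈ Submodule.map₂ V.adAction ⊤ (V.gr k)
    rw [lie_ad_lie]
    exact add_mem (Submodule.apply_mem_map₂ V.adAction Submodule.mem_top hn)
      (Submodule.apply_mem_map₂ V.adAction Submodule.mem_top (V.inl_lie_mem x k n hn))
  exact hle hm

/-- The element `v` generates `V` over `𝔤 ⋉ 𝔤_ad` and lies in degree zero, expressed degree by
degree: `V[0] = U(𝔤) v` and `V[k + 1] = 𝔤_ad V[k]`. -/
structure IsGradedGenerator (v : V.carrier) : Prop where
  gr_zero : V.gr 0 = (LieSubmodule.lieSpan ℂ 𝔤 {v}).toSubmodule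
  gr_succ_le : ∀ k, V.gr (k + 1) ≤ Submodule.map₂ V.adAction ⊤ (V.gr k)

namespace IsGradedGenerator

variable {V} {v : V.carrier}

theorem mem (h : V.IsGradedGenerator v) : v ∈ V.gr 0 :=
  h.gr_zero ▸ LieSubmodule.subset_lieSpan (Set.mem_singleton v)

theorem quotient (h : V.IsGradedGenerator v) {K : LieSubmodule ℂ (AdExt 𝔤) V.carrier}
    (hK : V.IsGraded K) : (V.quotient K hK).IsGradedGenerator (V.quotientMap hK v) := by
  refine ⟨?_, fun k ↦ Submodule.map_le_iff_le_comap.mpr ((h.gr_succ_le k).trans ?_)⟩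
  · rw [← Set.image_singleton, ← map_lieSpan, LieSubmodule.toSubmodule_map, ← h.gr_zero]
    rfl
  · refine Submodule.map₂_le.mpr fun x _ m hm ↦ ?_
    change V.quotientMap hK ⁅AdExt.ad x, m⁆ ∈ Submodule.map₂ (V.quotient K hK).adAction ⊤ _
    rw [quotientMap_lie]
    exact Submodule.apply_mem_map₂ (V.quotient K hK).adAction Submodule.mem_top
      ((V.mem_gr_quotient hK).mpr ⟨m, hm, rfl⟩)

theorem g2 [FiniteDimensional ℂ 𝔤] (h : V.IsGradedGenerator v)
    (h_zero : FiniteDimensional ℂ (V.gr 0)) : G2 V := by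
  intro k
  induction k with
  | zero => exact h_zero
  | succ k ih =>
    have hfg : (Submodule.map₂ V.adAction ⊤ (V.gr k)).FG :=
      Submodule.FG.map₂ V.adAction Module.Finite.fg_top (Module.Finite.iff_fg.mp ih)
    have := Module.Finite.iff_fg.mpr hfg
    exact Submodule.finiteDimensional_of_le (h.gr_succ_le k)

end IsGradedGenerator

end GradedLieMod

theorem IsMonomial.exists_eq_map_inl {j : ℕ} {u : UEnv (AdExt 𝔤)} (hu : IsMonomial j u)
    (hj : j = 0) : ∃ a : UEnv 𝔤, u = UEnv.map AdExt.inl a := by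
  induction hu with
  | one => exact ⟨1, (map_one _).symm⟩
  | inl_mul x _ ih =>
    obtain ⟨a, rfl⟩ := ih hj
    exact ⟨UEnv.ι x * a, by rw [map_mul, UEnv.map_ι]⟩
  | ad_mul => exact absurd hj (Nat.succ_ne_zero _)

namespace Induced

variable (V : Type u) [AddCommGroup V] [Module ℂ V] [Module (UEnv 𝔤) V]

theorem piece_eq_shift (r : ℕ) :
    piece (𝔤 := 𝔤) V r = fun k ↦ if r ≤ k then piece V 0 (k - r) else ⊥ := by
  funext k
  split_ifs with hk
  · obtain ⟨j, rfl⟩ := Nat.exists_eq_add_of_le hk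
    simp only [piece, add_right_inj, Nat.add_sub_cancel_left, zero_add]
  · rw [piece, Submodule.span_eq_bot]
    rintro _ ⟨a, u, v, h, _⟩
    omega

variable {V}

theorem tmul_map_inl (a : UEnv 𝔤) (w : V) : tmul (UEnv.map AdExt.inl a) w = tmul 1 (a • w) := by
  rw [← sub_eq_zero]
  exact (Submodule.Quotient.mk_eq_zero (balancedRel (𝔤 := 𝔤) V)).mpr
    (Submodule.subset_span ⟨1, a, w, by rw [one_mul]⟩)

theorem piece_zero_le {k : ℕ} {S : Submodule ℂ (Induced (𝔤 := 𝔤) V)}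
    (h : ∀ (u : UEnv (AdExt 𝔤)) (w : V), IsMonomial k u → tmul u w ∈ S) : piece V 0 k ≤ S := by
  refine Submodule.span_le.mpr ?_
  rintro _ ⟨a, u, w, ha, hu, rfl⟩
  rw [zero_add] at ha
  exact h u w (ha ▸ hu)

theorem tmul_mem_piece_zero {k : ℕ} {u : UEnv (AdExt 𝔤)} (hu : IsMonomial k u) (w : V) :
    tmul u w ∈ piece (𝔤 := 𝔤) V 0 k :=
  Submodule.subset_span ⟨k, u, w, zero_add k, hu, rfl⟩

variable [IsScalarTower ℂ (UEnv 𝔤) V]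

variable (V) in
theorem graded_eq_shiftObj (r : ℕ) :
    graded (𝔤 := 𝔤) V r = shiftObj r (graded V 0) := by
  unfold graded shiftObj
  congr
  exact piece_eq_shift V r

theorem inl_lie_tmul_one (x : 𝔤) (w : V) :
    ⁅AdExt.inl x, (tmul 1 w : Induced (𝔤 := 𝔤) V)⁆ = tmul 1 (UEnv.ι x • w) := by
  rw [lie_tmul, mul_one, ← UEnv.map_ι, tmul_map_inl]

theorem tmul_mem_map₂_adAction {j k : ℕ} {u : UEnv (AdExt 𝔤)} (hu : IsMonomial j u)
    (hj : j = k + 1) (w : V) :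
    (tmul u w : (graded (𝔤 := 𝔤) V 0).carrier) ∈
      Submodule.map₂ (graded V 0).adAction ⊤ ((graded V 0).gr k) := by
  induction hu with
  | one => exact absurd hj k.succ_ne_zero.symm
  | inl_mul x _ ih => exact lie_mem_map₂_adAction x (ih hj)
  | ad_mul x hu =>
    obtain rfl := Nat.succ_injective hj
    exact Submodule.apply_mem_map₂ (graded V 0).adAction Submodule.mem_top
      (tmul_mem_piece_zero hu w)

end Induced

end Generation

/-! ### Quotients of `P(μ, 0)` -/

section Projective

open LieAlgebra LieAlgebra.IsKilling LieModule GradedLieMod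

variable {𝔤 : Type u} [LieRing 𝔤] [LieAlgebra ℂ 𝔤] [FiniteDimensional ℂ 𝔤]
  [LieAlgebra.IsSimple ℂ 𝔤] {𝔥 : LieSubalgebra ℂ 𝔤} [𝔥.IsCartanSubalgebra]
  {b : (rootSystem 𝔥).Base} (μ : DominantWeight b)

theorem projectiveModule_eq_shiftObj (r : ℕ) :
    projectiveModule μ r = shiftObj r (projectiveModule μ 0) :=
  Induced.graded_eq_shiftObj (SimpleModule μ) r

/-- The embedding `w ↦ 1 ⊗ w` of `V(μ)` into `P(μ, 0)`. -/
def toProjective : SimpleModule μ →ₗ⁅ℂ,𝔤⁆ (projectiveModule μ 0).carrier where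
  __ := (Induced.tmulₗ (𝔤 := 𝔤) (SimpleModule μ)).comp
    (TensorProduct.mk ℂ (UEnv (AdExt 𝔤)) (SimpleModule μ) 1)
  map_lie' := fun {x w} ↦ (Induced.inl_lie_tmul_one x w).symm

theorem gr_zero_projectiveModule :
    (projectiveModule μ 0).gr 0 = (toProjective μ).range.toSubmodule := by
  refine le_antisymm (Induced.piece_zero_le fun u w hu ↦ ?_) ?_
  · obtain ⟨a, rfl⟩ := hu.exists_eq_map_inl rfl
    exact ⟨a • w, (Induced.tmul_map_inl a w).symm⟩
  · rintro _ ⟨w, rfl⟩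
    exact Induced.tmul_mem_piece_zero IsMonomial.one w

theorem isGradedGenerator_projectiveModule :
    (projectiveModule μ 0).IsGradedGenerator (toProjective μ (SimpleModule.mk μ 1)) where
  gr_zero := by
    rw [gr_zero_projectiveModule, ← LieModuleHom.map_top, ← SimpleModule.lieSpan_mk_one,
      map_lieSpan, Set.image_singleton]
  gr_succ_le k := Induced.piece_zero_le fun _ w hu ↦ Induced.tmul_mem_map₂_adAction hu rfl w

variable (K : LieSubmodule ℂ (AdExt 𝔤) (projectiveModule μ 0).carrier)

/-- The kernel of the map from `V(μ)` onto the degree zero part of `P(μ, 0) / K`. -/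
def degreeZeroKernel : LieSubmodule ℂ 𝔤 (SimpleModule μ) where
  __ := K.toSubmodule.comap (toProjective μ : SimpleModule μ →ₗ[ℂ] (projectiveModule μ 0).carrier)
  lie_mem {x w} hw := by
    change toProjective μ ⁅x, w⁆ ∈ K
    rw [LieModuleHom.map_lie]
    exact K.lie_mem (x := AdExt.inl x) hw

theorem degreeZeroKernel_sInf (S : Set (LieSubmodule ℂ (AdExt 𝔤) (projectiveModule μ 0).carrier)) :
    degreeZeroKernel μ (sInf S) = sInf (degreeZeroKernel μ '' S) := by
  rw [← SetLike.coe_set_eq, LieSubmodule.coe_sInf, Set.biInter_image]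
  change toProjective μ ⁻¹' (sInf S : LieSubmodule ℂ (AdExt 𝔤) _) = _
  rw [LieSubmodule.coe_sInf, Set.preimage_iInter₂]
  rfl

variable {K}

theorem finiteDimensional_gr_zero_quotient_iff (hK : (projectiveModule μ 0).IsGraded K) :
    FiniteDimensional ℂ (((projectiveModule μ 0).quotient K hK).gr 0) ↔
      FiniteDimensional ℂ (SimpleModule μ ⧸ degreeZeroKernel μ K) := by
  let f := ((projectiveModule μ 0).quotientMap hK).comp (toProjective μ)
  have hrange : ((projectiveModule μ 0).quotient K hK).gr 0 = LinearMap.range f.toLinearMap := by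
    change ((projectiveModule μ 0).gr 0).map _ = _
    rw [gr_zero_projectiveModule, LieModuleHom.toSubmodule_range, ← LinearMap.range_comp]
    rfl
  have hker : LinearMap.ker f.toLinearMap = (degreeZeroKernel μ K).toSubmodule :=
    Submodule.ext fun _ ↦ (projectiveModule μ 0).quotientMap_eq_zero_iff hK
  rw [hrange]
  change _ ↔ FiniteDimensional ℂ (SimpleModule μ ⧸ (degreeZeroKernel μ K).toSubmodule)
  rw [← hker]
  exact (Module.Finite.equiv_iff f.toLinearMap.quotKerEquivRange).symm

theorem g2_truncation_projectiveModule (Γ : Set (DominantWeight b × ℕ)) :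
    G2 (truncation Γ (projectiveModule μ 0)) := by
  refine ((isGradedGenerator_projectiveModule μ).quotient _).g2 ?_
  rw [finiteDimensional_gr_zero_quotient_iff, degreeZeroKernel_sInf]
  refine (SimpleModule.isSingular_mk_one μ).finiteDimensional_quotient_sInf
    (SimpleModule.lieSpan_mk_one μ) ?_
  rintro _ ⟨K, ⟨hK, hfd, -⟩, rfl⟩
  exact (finiteDimensional_gr_zero_quotient_iff μ hK).mp (hfd 0)

end Projective

/-! ### The pairing with a dominant weight -/

section Roots

open LieAlgebra LieAlgebra.IsKilling LieModule

variable {K L : Type*} [Field K] [CharZero K] [LieRing L] [LieAlgebra K L]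
  [FiniteDimensional K L] {H : LieSubalgebra K L} [H.IsCartanSubalgebra]
  [IsTriangularizable K H L]

theorem exists_root_eq_neg [IsKilling K L] (α : H.root) :
    ∃ β : H.root, (rootSystem H).root β = -(rootSystem H).root α :=
  ⟨(rootSystem H).reflectionPerm α α, by
    rw [RootPairing.root_reflectionPerm, RootPairing.reflection_apply_self]⟩

variable (H) in
theorem nonempty_root [LieAlgebra.IsSimple K L] : Nonempty H.root := by
  by_contra h
  rw [not_nonempty_iff] at h
  have hspan := RootPairing.IsRootSystem.span_root_eq_top (P := rootSystem H)
  rw [Set.range_eq_empty, Submodule.span_empty] at hspan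
  have : Nontrivial (Module.Dual K H) := RootPairing.IsIrreducible.nontrivial (rootSystem H)
  exact bot_ne_top hspan

end Roots

section Pairing

open LieAlgebra LieAlgebra.IsKilling LieModule

variable {𝔤 : Type u} [LieRing 𝔤] [LieAlgebra ℂ 𝔤] [FiniteDimensional ℂ 𝔤]
  {𝔥 : LieSubalgebra ℂ 𝔤} [𝔥.IsCartanSubalgebra]

/-- The real part of the pairing with a fixed linear form; the pairings of interest are real. -/
def rePairing [IsKilling ℂ 𝔤] (ξ : Module.Dual ℂ 𝔥) : Module.Dual ℂ 𝔥 →+ ℝ :=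
  Complex.reAddGroupHom.comp (dualKillingForm 𝔥 ξ).toAddMonoidHom

theorem IsDominantIntegral.rePairing_nonneg [IsKilling ℂ 𝔤] {b : (rootSystem 𝔥).Base}
    {ξ : Module.Dual ℂ 𝔥} (hξ : IsDominantIntegral b ξ) {p : Module.Dual ℂ 𝔥}
    (hp : p ∈ posCone b) : 0 ≤ rePairing ξ p := by
  obtain ⟨r, hr, h⟩ := hξ.exists_nonneg_rat_dualKillingForm hp
  change 0 ≤ (dualKillingForm 𝔥 ξ p).re
  rwa [h, Complex.ratCast_re, Rat.cast_nonneg]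

variable [LieAlgebra.IsSimple ℂ 𝔤] {b : (rootSystem 𝔥).Base} {ξ : DominantWeight b}

theorem dualForm_re (k : Module.Dual ℂ 𝔥) : (dualForm k ξ.1).re = rePairing ξ.1 k := by
  change _ = (dualKillingForm 𝔥 ξ.1 k).re
  rw [dualKillingForm_comm, dualKillingForm_eq_killingForm, dualForm]

theorem mem_maximalRoots_iff {α : 𝔥.root} : α ∈ maximalRoots ξ ↔
    ∀ β, rePairing ξ.1 ((rootSystem 𝔥).root β) ≤ rePairing ξ.1 ((rootSystem 𝔥).root α) := by
  simp only [← dualForm_re]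
  rfl

variable (ξ) in
theorem maximalRoots_nonempty : (maximalRoots ξ).Nonempty := by
  have := nonempty_root 𝔥
  obtain ⟨β, hβ⟩ := Finite.exists_max fun β ↦ rePairing ξ.1 ((rootSystem 𝔥).root β)
  exact ⟨β, mem_maximalRoots_iff.mpr hβ⟩

variable {β : 𝔥.root} (hβ : β ∈ maximalRoots ξ)

include hβ in
theorem rePairing_eq_of_mem_maximalRoots {γ : 𝔥.root} (hγ : γ ∈ maximalRoots ξ) :
    rePairing ξ.1 ((rootSystem 𝔥).root γ) = rePairing ξ.1 ((rootSystem 𝔥).root β) :=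
  le_antisymm (mem_maximalRoots_iff.mp hβ γ) (mem_maximalRoots_iff.mp hγ β)

include hβ in
theorem mem_maximalRoots_of_root_eq_neg {α γ : 𝔥.root}
    (hγ : (rootSystem 𝔥).root γ = -(rootSystem 𝔥).root α)
    (hα : rePairing ξ.1 ((rootSystem 𝔥).root α) ≤ -rePairing ξ.1 ((rootSystem 𝔥).root β)) :
    γ ∈ maximalRoots ξ := by
  refine mem_maximalRoots_iff.mpr fun δ ↦ ?_
  rw [hγ, map_neg]
  linarith [mem_maximalRoots_iff.mp hβ δ]

include hβ in
/- Otherwise `-β` would also be maximal, hence positive. -/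
theorem rePairing_pos_of_mem_maximalRoots (hξ : maximalRoots ξ ⊆ positiveRoots b) :
    0 < rePairing ξ.1 ((rootSystem 𝔥).root β) := by
  by_contra! hle
  obtain ⟨γ, hγ⟩ := exists_root_eq_neg β
  have hγ_max : γ ∈ maximalRoots ξ := mem_maximalRoots_of_root_eq_neg hβ hγ (by linarith)
  refine (rootSystem 𝔥).ne_zero β (eq_zero_of_add_eq_zero_of_mem_posCone (hξ hβ) (hξ hγ_max) ?_)
  rw [hγ, add_neg_cancel]

include hβ in
theorem rePairing_sub_sum_root (k : Module.Dual ℂ 𝔥) {n : 𝔥.root → ℕ}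
    (hn : ∀ γ ∉ maximalRoots ξ, n γ = 0) :
    rePairing ξ.1 (k - ∑ γ, n γ • (rootSystem 𝔥).root γ) =
      rePairing ξ.1 k - (∑ γ, n γ : ℕ) * rePairing ξ.1 ((rootSystem 𝔥).root β) := by
  rw [map_sub, map_sum, Nat.cast_sum, Finset.sum_mul]
  congr 1
  refine Finset.sum_congr rfl fun γ _ ↦ ?_
  rw [map_nsmul, nsmul_eq_mul]
  by_cases hγ : γ ∈ maximalRoots ξ
  · rw [rePairing_eq_of_mem_maximalRoots hβ hγ]
  · rw [hn γ hγ, Nat.cast_zero, zero_mul, zero_mul]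

include hβ in
theorem rePairing_of_mem_gammaSet {lam ν : DominantWeight b} {s : ℕ}
    (h : (ν, s) ∈ GammaSet lam (maximalRoots ξ)) :
    rePairing ξ.1 ν.1 =
      rePairing ξ.1 lam.1 - s * rePairing ξ.1 ((rootSystem 𝔥).root β) := by
  obtain ⟨n, hn, hν, rfl⟩ := h
  exact (congrArg _ hν).trans (rePairing_sub_sum_root hβ lam.1 hn)

theorem gammaSet_subset_shiftDown {lam μ : DominantWeight b} {Ψ : Set 𝔥.root} {r : ℕ}
    (hμ : (μ, r) ∈ GammaSet lam Ψ) : GammaSet μ Ψ ⊆ shiftDown r (GammaSet lam Ψ) := by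
  rintro ⟨ν, _⟩ ⟨m, hm, hν, rfl⟩
  obtain ⟨n, hn, hμ, rfl⟩ := hμ
  refine ⟨n + m, fun β hβ ↦ by rw [Pi.add_apply, hm β hβ, hn β hβ], ?_, ?_⟩
  · simp only [Pi.add_apply, add_smul, Finset.sum_add_distrib, ← sub_sub]
    exact hν.trans (congrArg (· - _) hμ)
  · simp only [Pi.add_apply, Finset.sum_add_distrib]
    exact add_comm _ _

end Pairing

/-! ### Generators over `U(𝔫⁻)` -/

section AdGenerators

open LieAlgebra LieAlgebra.IsKilling LieModule GradedLieMod

variable {𝔤 : Type u} [LieRing 𝔤] [LieAlgebra ℂ 𝔤] [FiniteDimensional ℂ 𝔤]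
  {𝔥 : LieSubalgebra ℂ 𝔤} [𝔥.IsCartanSubalgebra] {Q : GradedLieMod 𝔤} {v : Q.carrier}

/-- The elements obtained from `v` by applying `s` root vectors of `𝔤_ad` for the negatives of the
roots in `Ψ`; under the hypotheses of the theorem they generate `Q[s]` over `U(𝔫⁻)`. -/
def adGenerators (v : Q.carrier) (Ψ : Set 𝔥.root) : ℕ → Set Q.carrier
  | 0 => {v}
  | s + 1 => {t | ∃ β ∈ Ψ, ∃ x ∈ rootSpace 𝔥 (-(β.1 : 𝔥 → ℂ)), ∃ a ∈ adGenerators v Ψ s,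
      t = ⁅AdExt.ad x, a⁆}

theorem adGenerators_subset_gr (hv : v ∈ Q.gr 0) (Ψ : Set 𝔥.root) (s : ℕ) :
    adGenerators v Ψ s ⊆ Q.gr s := by
  induction s with
  | zero => exact Set.singleton_subset_iff.mpr hv
  | succ s ih =>
    rintro _ ⟨β, -, x, -, a, ha, rfl⟩
    exact Q.ad_lie_mem x s a (ih ha)

variable [IsKilling ℂ 𝔤]

theorem IsWeightVec.ad_lie {k γ : Module.Dual ℂ 𝔥} {m : Q.carrier} (hm : IsWeightVec k m) {x : 𝔤}
    (hx : x ∈ rootSpace 𝔥 (γ : 𝔥 → ℂ)) : IsWeightVec (k + γ) ⁅AdExt.ad x, m⁆ := by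
  intro h
  have hγ : ⁅(h : 𝔤), x⁆ = γ h • x := lie_eq_smul_of_mem_rootSpace hx h
  rw [lie_ad_lie, hγ, hm h, map_smul, smul_lie, lie_smul, ← add_smul, add_comm, LinearMap.add_apply]

theorem exists_isWeightVec_of_mem_adGenerators {μ : Module.Dual ℂ 𝔥} (hv : IsWeightVec μ v)
    {Ψ : Set 𝔥.root} {s : ℕ} {a : Q.carrier} (ha : a ∈ adGenerators v Ψ s) :
    ∃ n : 𝔥.root → ℕ, (∀ β ∉ Ψ, n β = 0) ∧
      IsWeightVec (μ - ∑ β, n β • (rootSystem 𝔥).root β) a ∧ ∑ β, n β = s := by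
  classical
  induction s generalizing a with
  | zero =>
    obtain rfl : a = v := ha
    refine ⟨0, fun _ _ ↦ rfl, ?_, Finset.sum_const_zero⟩
    simpa only [Pi.zero_apply, zero_smul, Finset.sum_const_zero, sub_zero] using hv
  | succ s ih =>
    obtain ⟨β, hβ, x, hx, a, ha, rfl⟩ := ha
    obtain ⟨n, hn, hw, rfl⟩ := ih ha
    refine ⟨n + Pi.single β 1, fun γ hγ ↦ ?_, ?_, ?_⟩
    · rw [Pi.add_apply, hn γ hγ, Pi.single_eq_of_ne (ne_of_mem_of_not_mem hβ hγ).symm, add_zero]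
    · have hβ_sum : ∑ γ, (Pi.single β 1 : 𝔥.root → ℕ) γ • (rootSystem 𝔥).root γ =
          (rootSystem 𝔥).root β := by
        rw [Fintype.sum_eq_single β fun γ hγ ↦ by rw [Pi.single_eq_of_ne hγ, zero_smul],
          Pi.single_eq_same, one_smul]
      simp only [Pi.add_apply, add_smul, Finset.sum_add_distrib, hβ_sum, ← sub_sub]
      rw [sub_eq_add_neg _ ((rootSystem 𝔥).root β)]
      exact hw.ad_lie hx
    · simp only [Pi.add_apply, Finset.sum_add_distrib, Finset.sum_pi_single', Finset.mem_univ,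
        if_true]

variable {b : (rootSystem 𝔥).Base}

theorem isNegStable_iInf_comap_adAction {N : Submodule ℂ Q.carrier} (hN : IsNegStable b N) :
    IsNegStable b (⨅ x, N.comap (Q.adAction x)) := by
  intro i hi y hy m hm
  rw [Submodule.mem_iInf] at hm ⊢
  intro x
  change ⁅AdExt.ad x, ⁅y, m⁆⁆ ∈ N
  rw [← sub_eq_iff_eq_add'.mpr (lie_ad_lie Q y x m)]
  exact sub_mem (hN i hi y hy _ (hm x)) (hm ⁅y, x⁆)

theorem GradedLieMod.IsGradedGenerator.gr_le_negSpan_adGenerators (h : Q.IsGradedGenerator v)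
    {μ : Module.Dual ℂ 𝔥} (hv : IsSingular b μ v) {Ψ : Set 𝔥.root}
    (hΨ : ∀ s, ∀ a ∈ adGenerators v Ψ s, ∀ x : 𝔤,
      ⁅AdExt.ad x, a⁆ ∈ Submodule.span ℂ (adGenerators v Ψ (s + 1))) (s : ℕ) :
    Q.gr s ≤ negSpan b (adGenerators v Ψ s) := by
  induction s with
  | zero =>
    rw [h.gr_zero, adGenerators,
      negSpan_eq_lieSpan fun a ha ↦ ⟨μ, Set.mem_singleton_iff.mp ha ▸ hv⟩]
  | succ s ih =>
    have hle : negSpan b (adGenerators v Ψ s) ≤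
        ⨅ x, (negSpan b (adGenerators v Ψ (s + 1))).comap (Q.adAction x) := by
      refine negSpan_le (fun a ha ↦ (Submodule.mem_iInf _).mpr fun x ↦ ?_)
        (isNegStable_iInf_comap_adAction isNegStable_negSpan)
      exact Submodule.span_le.mpr subset_negSpan (hΨ s a ha x)
    refine (h.gr_succ_le s).trans (Submodule.map₂_le.mpr fun x _ m hm ↦ ?_)
    exact (Submodule.mem_iInf _).mp (hle (ih hm)) x

end AdGenerators

section Main

open LieAlgebra LieAlgebra.IsKilling LieModule GradedLieMod

variable {𝔤 : Type u} [LieRing 𝔤] [LieAlgebra ℂ 𝔤] [FiniteDimensional ℂ 𝔤]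
  [LieAlgebra.IsSimple ℂ 𝔤] {𝔥 : LieSubalgebra ℂ 𝔤} [𝔥.IsCartanSubalgebra]
  {b : (rootSystem 𝔥).Base} {Q : GradedLieMod 𝔤} {ξ lam μ : DominantWeight b} {r : ℕ}

/- By `rePairing_of_mem_gammaSet` equality holds for the singular weights of `Q[s]`; from any other
weight one arrives at a singular one by adding an element of the positive cone. -/
theorem IsWeightVec.rePairing_le_of_g2Gamma
    (hQ : G2Gamma (shiftDown r (GammaSet lam (maximalRoots ξ))) Q)
    {β : 𝔥.root} (hβ : β ∈ maximalRoots ξ) {s : ℕ} {a : Q.carrier} (ha : a ∈ Q.gr s)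
    (ha0 : a ≠ 0) {k : Module.Dual ℂ 𝔥} (hk : IsWeightVec k a) :
    rePairing ξ.1 k ≤
      rePairing ξ.1 lam.1 - (s + r : ℕ) * rePairing ξ.1 ((rootSystem 𝔥).root β) := by
  obtain ⟨hfd, hQ⟩ := g2Gamma_iff.mp hQ
  have := hfd s
  let t : Q.gr s := ⟨a, ha⟩
  have ht : IsWeightVec k t := fun h ↦ Subtype.ext (hk h)
  obtain ⟨p, hp, w, hw0, hw⟩ := ht.exists_isSingular_add (fun h ↦ ha0 (congrArg Subtype.val h)) b
  obtain ⟨ν, hν⟩ : ∃ ν : DominantWeight b, ν.1 = k + p := ⟨⟨_, hw.isDominantIntegral hw0⟩, rfl⟩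
  rw [← hν] at hw
  have hνξ := rePairing_of_mem_gammaSet hβ
    (hQ ν s w w.2 (fun h ↦ hw0 (Subtype.ext h)) (isSingular_coe_iff.mpr hw))
  rw [← hνξ, hν, map_add]
  exact le_add_of_nonneg_right (IsDominantIntegral.rePairing_nonneg ξ.2 hp)

theorem ad_lie_eq_zero_of_g2Gamma (hQ : G2Gamma (shiftDown r (GammaSet lam (maximalRoots ξ))) Q)
    {β : 𝔥.root} (hβ : β ∈ maximalRoots ξ) {s : ℕ} {a : Q.carrier} (ha : a ∈ Q.gr s)
    {k : Module.Dual ℂ 𝔥} (hk : IsWeightVec k a)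
    (hkξ : rePairing ξ.1 k =
      rePairing ξ.1 lam.1 - (s + r : ℕ) * rePairing ξ.1 ((rootSystem 𝔥).root β))
    {γ : Module.Dual ℂ 𝔥}
    (hγ : -rePairing ξ.1 ((rootSystem 𝔥).root β) < rePairing ξ.1 γ) {x : 𝔤}
    (hx : x ∈ rootSpace 𝔥 (γ : 𝔥 → ℂ)) : ⁅AdExt.ad x, a⁆ = 0 := by
  by_contra h0
  have hle := (hk.ad_lie hx).rePairing_le_of_g2Gamma hQ hβ (Q.ad_lie_mem x s a ha) h0
  rw [map_add, hkξ, add_right_comm, Nat.cast_succ] at hle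
  linarith

variable {v : Q.carrier}

theorem ad_lie_mem_span_adGenerators (hv0 : v ∈ Q.gr 0) (hv : IsWeightVec μ.1 v)
    (hξ : maximalRoots ξ ⊆ positiveRoots b) (hμ : (μ, r) ∈ GammaSet lam (maximalRoots ξ))
    (hQ : G2Gamma (shiftDown r (GammaSet lam (maximalRoots ξ))) Q) {s : ℕ} {a : Q.carrier}
    (ha : a ∈ adGenerators v (maximalRoots ξ) s) (x : 𝔤) :
    ⁅AdExt.ad x, a⁆ ∈ Submodule.span ℂ (adGenerators v (maximalRoots ξ) (s + 1)) := by
  obtain ⟨β, hβ⟩ := maximalRoots_nonempty ξ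
  have hzero {γ : Module.Dual ℂ 𝔥}
      (hγ : -rePairing ξ.1 ((rootSystem 𝔥).root β) < rePairing ξ.1 γ) {y : 𝔤}
      (hy : y ∈ rootSpace 𝔥 (γ : 𝔥 → ℂ)) : ⁅AdExt.ad y, a⁆ = 0 := by
    obtain ⟨n, hn, hk, hs⟩ := exists_isWeightVec_of_mem_adGenerators hv ha
    refine ad_lie_eq_zero_of_g2Gamma hQ hβ (adGenerators_subset_gr hv0 _ s ha) hk ?_ hγ hy
    rw [rePairing_sub_sum_root hβ _ hn, rePairing_of_mem_gammaSet hβ hμ, hs]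
    push_cast
    ring
  let S := (Submodule.span ℂ (adGenerators v (maximalRoots ξ) (s + 1))).comap (Q.adAction.flip a)
  suffices hS_top : S = ⊤ by
    have hx : x ∈ S := hS_top ▸ Submodule.mem_top
    exact hx
  have hS {y : 𝔤} (hy : ⁅AdExt.ad y, a⁆ = 0) : y ∈ S :=
    Submodule.mem_comap.mpr (hy.symm ▸ zero_mem _ : ⁅AdExt.ad y, a⁆ ∈ Submodule.span ℂ _)
  refine eq_top_of_cartan_le_of_rootSpace_le (H := 𝔥) S (fun y ↦ hS (hzero (γ := 0) ?_ ?_))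
    fun α y hy ↦ ?_
  · rw [map_zero, neg_lt_zero]
    exact rePairing_pos_of_mem_maximalRoots hβ hξ
  · exact coe_mem_rootSpace_zero y
  · obtain hα | hα := lt_or_ge (-rePairing ξ.1 ((rootSystem 𝔥).root β))
      (rePairing ξ.1 ((rootSystem 𝔥).root α))
    · exact hS (hzero hα hy)
    · obtain ⟨γ, hγ⟩ := exists_root_eq_neg α
      have hαγ : (α.1 : 𝔥 → ℂ) = -γ.1 := funext fun t ↦
        neg_eq_iff_eq_neg.mp (DFunLike.congr_fun hγ t).symm
      exact Submodule.subset_span ⟨γ, mem_maximalRoots_of_root_eq_neg hβ hγ hα, y, hαγ ▸ hy, a,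
        ha, rfl⟩

theorem GradedLieMod.IsGradedGenerator.g2Gamma_gammaSet (h : Q.IsGradedGenerator v)
    (hv : IsSingular b μ.1 v) (hξ : maximalRoots ξ ⊆ positiveRoots b)
    (hμ : (μ, r) ∈ GammaSet lam (maximalRoots ξ))
    (hQ : G2Gamma (shiftDown r (GammaSet lam (maximalRoots ξ))) Q) :
    G2Gamma (GammaSet μ (maximalRoots ξ)) Q := by
  refine g2Gamma_iff.mpr ⟨hQ.1, fun ν s w hw hw0 hs ↦ ?_⟩
  have := hQ.1 s
  have hA := adGenerators_subset_gr h.mem (maximalRoots ξ) s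
  have hgr := h.gr_le_negSpan_adGenerators hv (fun s a ha x ↦
    ad_lie_mem_span_adGenerators h.mem hv.isWeightVec hξ hμ hQ ha x) s
  have htop : negSpan b (Q.grIncl s ⁻¹' adGenerators v (maximalRoots ξ) s) = ⊤ :=
    negSpan_preimage_eq_top Subtype.val_injective (fun a ha ↦ ⟨⟨a, hA ha⟩, rfl⟩)
      fun m ↦ hgr m.2
  have hw' : IsSingular b ν.1 (⟨w, hw⟩ : Q.gr s) := isSingular_coe_iff.mp hs
  have hwt (a : Q.gr s) (ha : Q.grIncl s a ∈ adGenerators v (maximalRoots ξ) s) :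
      ∃ k : Module.Dual ℂ 𝔥, IsWeightVec k a := by
    obtain ⟨n, -, hk, -⟩ := exists_isWeightVec_of_mem_adGenerators hv.isWeightVec ha
    exact ⟨_, fun t ↦ Subtype.ext (hk t)⟩
  obtain ⟨a, ha, ha0, haν⟩ := hw'.exists_isWeightVec_of_negSpan_eq_top
    (fun h ↦ hw0 (congrArg Subtype.val h)) htop hwt
  obtain ⟨n, hn, hk, hns⟩ := exists_isWeightVec_of_mem_adGenerators hv.isWeightVec ha
  exact ⟨n, hn, (haν.map (Q.grIncl s)).eq_of_ne_zero hk fun h ↦ ha0 (Subtype.ext h), hns⟩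

theorem g2Gamma_mono {Γ Γ' : Set (DominantWeight b × ℕ)} (h : Γ ⊆ Γ') (hQ : G2Gamma Γ Q) :
    G2Gamma Γ' Q :=
  ⟨hQ.1, fun p hp ↦ h (hQ.2 p hp)⟩

theorem truncation_shiftDown_projectiveModule (hξ : maximalRoots ξ ⊆ positiveRoots b)
    (hμ : (μ, r) ∈ GammaSet lam (maximalRoots ξ)) :
    truncation (shiftDown r (GammaSet lam (maximalRoots ξ))) (projectiveModule μ 0) =
      truncation (GammaSet μ (maximalRoots ξ)) (projectiveModule μ 0) := by
  refine truncation_congr (Set.ext fun K ↦ exists_congr fun hK ↦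
    ⟨fun hQ ↦ ?_, g2Gamma_mono (gammaSet_subset_shiftDown hμ)⟩)
  exact ((isGradedGenerator_projectiveModule μ).quotient hK).g2Gamma_gammaSet
    (((SimpleModule.isSingular_mk_one μ).map (toProjective μ)).map
      ((projectiveModule μ 0).quotientMap hK)) hξ hμ hQ

end Main

end

theorem mainTheorem4 (𝔤 : Type u) [LieRing 𝔤] [LieAlgebra ℂ 𝔤] [FiniteDimensional ℂ 𝔤]
    [LieAlgebra.IsSimple ℂ 𝔤] (𝔥 : LieSubalgebra ℂ 𝔤) [𝔥.IsCartanSubalgebra]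
    (b : (LieAlgebra.IsKilling.rootSystem 𝔥).Base)
    (Ψ : Set 𝔥.root) (hpos : Ψ ⊆ positiveRoots b)
    (hmax : ∃ ξ : DominantWeight b, Ψ = maximalRoots ξ)
    (lam μ : DominantWeight b) (r : ℕ) (hμ : (μ, r) ∈ GammaSet lam Ψ) :
    G2Gamma (GammaSet lam Ψ) (truncation (GammaSet lam Ψ) (projectiveModule μ r)) ∧
    G2Gamma (GammaSet μ Ψ) (truncation (GammaSet μ Ψ) (projectiveModule μ 0)) ∧
    Nonempty ((GradedLieMod.shift r).obj (truncation (GammaSet μ Ψ) (projectiveModule μ 0)) ≅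
      truncation (GammaSet lam Ψ) (projectiveModule μ r)) := by
  obtain ⟨ξ, rfl⟩ := hmax
  have h_iso : truncation (GammaSet lam (maximalRoots ξ)) (projectiveModule μ r) =
      GradedLieMod.shiftObj r
        (truncation (GammaSet μ (maximalRoots ξ)) (projectiveModule μ 0)) := by
    rw [projectiveModule_eq_shiftObj, truncation_shiftObj,
      truncation_shiftDown_projectiveModule hpos hμ]
  have hΓμ := g2Gamma_truncation
    (g2_truncation_projectiveModule μ (GammaSet μ (maximalRoots ξ)))
  refine ⟨?_, hΓμ, ⟨eqToIso h_iso.symm⟩⟩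
  rw [h_iso, g2Gamma_shiftObj_iff]
  exact g2Gamma_mono (gammaSet_subset_shiftDown hμ) hΓμ
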